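/- Let $\Bbbk=\mathbb{R}$ or $\mathbb{C}$. Let $A\in\Bbbk^{m\times n}$ have rank $r$ and let $A=U\Sigma V^H$ be a full singular value decomposition, where $U\in\Bbbk^{m\times m}$ and $V\in\Bbbk^{n\times n}$ are unitary and $\Sigma\in\mathbb{R}^{m\times n}$ is diagonal with diagonal entries given by $\sigma_1\ge\cdots\ge\sigma_r>\sigma_{r+1}=\cdots=\sigma_m=0$. For $\pi\subset\{1,\ldots,m\}$ with complement $\pi^c$ and $k=\sharp\pi$, let $\mathcal{U}_\pi\subset\Bbbk^{m\times n}$ be the set of matrices $B$ for which the span of the columns at the positions in $\pi$ of the left factor of a full singular value decomposition of $B$ (singular values in decreasing order) is a left singular subspace of $B$, i.e., a sum of full left singular subspaces associated with distinct singular values of $B$ (including the cokernel, for the value $0$). Let $\mathcal{L}_\pi:\mathcal{U}_\pi\to\mathrm{Gr}(k,\Bbbk^m)$ map $B$ to that subspace, and let $d_{\mathrm{Gr}}^\star$ be the chordal ($\|\sin\boldsymbol\theta\|$), Grassmann ($\|\boldsymbol\theta\|$), or Procrustes ($\|2\sin(\boldsymbol\theta/2)\|$) distance, where $\boldsymbol\theta$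 is the vector of principal angles between two subspaces. Let $$\kappa[\mathcal{L}_\pi](A)=\lim_{\epsilon\to0}\ \sup_{\substack{B\in\mathcal{U}_\pi,\\ 0<\|A-B\|_F\le\epsilon}}\frac{d_{\mathrm{Gr}}^\star(\mathcal{L}_\pi(A),\mathcal{L}_\pi(B))}{\|A-B\|_F}$$ be Rice's condition number. Assume that $A\in\mathcal{U}_\pi$, and let $i\in\pi$ and $j\in\pi^c$ be any indices attaining the maximum $$\max_{i\in\pi,\ j\in\pi^c}\ \frac{1}{|\sigma_i-\sigma_j|}\sqrt{\frac{\sigma_i^2+\sigma_j^2}{(\sigma_i+\sigma_j)^2}}.$$ Put $$\dot A=U(\mathbf e_j\mathbf e_i^T-\mathbf e_i\mathbf e_j^T)\Sigma V^H+\begin{cases}2\frac{\sigma_i\sigma_j}{\sigma_i^2+\sigma_j^2}\,U\Sigma(\mathbf e_i\mathbf e_j^T-\mathbf e_j\mathbf e_i^T)V^H,&\text{if }1\le i,j\le r,\\0,&\text{otherwise.}\end{cases}$$ Then, for each of the three distances, $\kappa[\mathcal{L}_\pi](A)$ is finite, $\dot A\ne0$, and $\dot A$ infinitesimally attains the condition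 number: for all sufficiently small real $t\neq 0$ we have $A+t\dot A\in\mathcal{U}_\pi$, and $$d_{\mathrm{Gr}}^\star\bigl(\mathcal{L}_\pi(A),\mathcal{L}_\pi(A+t\dot A)\bigr)=\kappa[\mathcal{L}_\pi](A)\cdot\|t\dot A\|_F\cdot(1+o(1))\qquad\text{as }t\to0.$$ -/

import Mathlib

open Filter Topology
open scoped Matrix ENNReal

-- Throughout, `‖M‖` for a matrix `M` is the Frobenius norm.
open scoped Matrix.Norms.Frobenius

namespace SingularSubspace

section Definitions

variable {𝕜 : Type*} [RCLike 𝕜]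

/-- Rice's condition number of a map `f` between spaces with distances `dX` and `dY`:
`lim_{ε → 0} sup_{0 < dX x x' ≤ ε} dY (f x) (f x') / dX x x'`. The supremum is monotone in `ε`,
so that the limit is the infimum over `ε > 0`. -/
noncomputable def riceCond {X Y : Type*} (dX : X → X → ℝ) (dY : Y → Y → ℝ) (f : X → Y) (x : X) :
    ℝ≥0∞ :=
  ⨅ (ε : ℝ) (_ : 0 < ε), ⨆ (x' : X) (_ : 0 < dX x x' ∧ dX x x' ≤ ε),
    ENNReal.ofReal (dY (f x) (f x') / dX x x')

/-- The Grassmannian `Gr(d, 𝕜^p)`, realized as the set of rank-`d` orthogonal projectors. -/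
def Grassmannian (𝕜 : Type*) [RCLike 𝕜] (d p : ℕ) : Set (Matrix (Fin p) (Fin p) 𝕜) :=
  {P | ∃ Q : Matrix (Fin p) (Fin d) 𝕜, Qᴴ * Q = 1 ∧ P = Q * Qᴴ}

/-- A matrix `Q` with orthonormal columns and `P = Q * Qᴴ`. -/
noncomputable def frame {d p : ℕ} (P : Grassmannian 𝕜 d p) : Matrix (Fin p) (Fin d) 𝕜 :=
  P.2.choose

/-- The singular values of a matrix in decreasing order, indexed from `0`, continued by zeros. -/
noncomputable def singVal {p q : ℕ} (M : Matrix (Fin p) (Fin q) 𝕜) (k : ℕ) : ℝ :=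
  (Matrix.toEuclideanLin M).singularValues k

/-- The principal angles `arccos (σ_k (Qᴴ * Q'))` between two points of the Grassmannian
(they do not depend on the choice of the frames `Q` and `Q'`). -/
noncomputable def principalAngle {d p : ℕ} (P P' : Grassmannian 𝕜 d p) (k : Fin d) : ℝ :=
  Real.arccos (singVal ((frame P)ᴴ * frame P') k)

/-- The labels of the three distances on the Grassmannian. -/
inductive GrMetric
  | chordal
  | grassmann
  | procrustes

/-- The chordal distance `‖sin θ‖`, the Grassmann distance `‖θ‖` and the Procrustes distance
`‖2 sin (θ / 2)‖`, where `θ` is the vector of principal angles. -/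
noncomputable def GrMetric.dist {d p : ℕ} (s : GrMetric) (P P' : Grassmannian 𝕜 d p) : ℝ :=
  match s with
  | .chordal => √(∑ k, Real.sin (principalAngle P P' k) ^ 2)
  | .grassmann => √(∑ k, principalAngle P P' k ^ 2)
  | .procrustes => √(∑ k, (2 * Real.sin (principalAngle P P' k / 2)) ^ 2)

/-- The rectangular diagonal `m × n` matrix with diagonal entries `σ 0, σ 1, …`. -/
def rectDiag (𝕜 : Type*) [RCLike 𝕜] (n : ℕ) {m : ℕ} (σ : Fin m → ℝ) : Matrix (Fin m) (Fin n) 𝕜 :=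
  Matrix.of fun a b => if a.val = b.val then (σ a : 𝕜) else 0

/-- `A = U Σ Vᴴ` is a full singular value decomposition, with
`σ_1 ≥ ⋯ ≥ σ_r > σ_{r+1} = ⋯ = σ_m = 0` where `r` is the rank of `A`. -/
structure IsFullSVD {m n : ℕ} (A : Matrix (Fin m) (Fin n) 𝕜) (U : Matrix (Fin m) (Fin m) 𝕜)
    (σ : Fin m → ℝ) (V : Matrix (Fin n) (Fin n) 𝕜) : Prop where
  unitary_left : U ∈ Matrix.unitaryGroup (Fin m) 𝕜
  unitary_right : V ∈ Matrix.unitaryGroup (Fin n) 𝕜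
  antitone : Antitone σ
  pos : ∀ k : Fin m, k.val < A.rank → 0 < σ k
  zero : ∀ k : Fin m, A.rank ≤ k.val → σ k = 0
  eq : A = U * rectDiag 𝕜 n σ * Vᴴ

/-- `W` is a left singular subspace of `A`: for a set `S` of singular values of `A` (the value `0`
is always allowed) it is the sum, over `s ∈ S`, of the left singular subspaces associated with `s`,
the eigenspaces of `A * Aᴴ` for `s ^ 2`. -/
def IsLeftSingularSubspace {m n : ℕ} (A : Matrix (Fin m) (Fin n) 𝕜)
    (W : Submodule 𝕜 (Fin m → 𝕜)) : Prop :=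
  ∃ S : Set ℝ, S ⊆ Set.range (singVal A) ∧
    W = ⨆ s ∈ S, Module.End.eigenspace (Matrix.toLin' (A * Aᴴ)) ((s ^ 2 : ℝ) : 𝕜)

/-- The columns of `U` at the positions in `π`. -/
def selectedCols {m : ℕ} (π : Finset (Fin m)) (U : Matrix (Fin m) (Fin m) 𝕜) :
    Matrix (Fin m) (Fin π.card) 𝕜 :=
  U.submatrix id (π.orderEmbOfFin rfl)

/-- The set `𝒰_π` of the matrices for which the span of the left singular vectors at the positions
in `π` (in a full singular value decomposition) is a left singular subspace. -/
def leftDomain (𝕜 : Type*) [RCLike 𝕜] {m : ℕ} (n : ℕ) (π : Finset (Fin m)) :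
    Set (Matrix (Fin m) (Fin n) 𝕜) :=
  {A | ∃ U σ V, IsFullSVD A U σ V ∧
    IsLeftSingularSubspace A (Submodule.span 𝕜 (Set.range (selectedCols π U).col))}

theorem selectedCols_orthonormal {m : ℕ} (π : Finset (Fin m)) {U : Matrix (Fin m) (Fin m) 𝕜}
    (hU : U ∈ Matrix.unitaryGroup (Fin m) 𝕜) : (selectedCols π U)ᴴ * selectedCols π U = 1 := by
  have h : Uᴴ * U = 1 := Matrix.mem_unitaryGroup_iff'.1 hU
  have h2 : (selectedCols π U)ᴴ * selectedCols π U
      = (Uᴴ * U).submatrix (π.orderEmbOfFin rfl) (π.orderEmbOfFin rfl) := by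
    ext a b
    simp [selectedCols, Matrix.mul_apply]
  rw [h2, h]
  exact Matrix.submatrix_one_embedding (π.orderEmbOfFin rfl).toEmbedding

/-- The map `ℒ_π : 𝒰_π → Gr(#π, 𝕜^m)` that takes a matrix to (the orthogonal projector onto) the
span of its left singular vectors at the positions in `π`. On `𝒰_π` this does not depend on the
choice of the singular value decomposition. -/
noncomputable def leftMap {m n : ℕ} (π : Finset (Fin m)) (A : leftDomain 𝕜 n π) :
    Grassmannian 𝕜 π.card m :=
  ⟨selectedCols π A.2.choose * (selectedCols π A.2.choose)ᴴ, selectedCols π A.2.choose,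
    selectedCols_orthonormal π A.2.choose_spec.choose_spec.choose_spec.1.unitary_left, rfl⟩

/-- The condition number of `ℒ_π` at `A`, for the Euclidean (Frobenius) distance on the matrices and
one of the three distances on the Grassmannian. -/
noncomputable def leftCond {m n : ℕ} (s : GrMetric) (π : Finset (Fin m)) (A : leftDomain 𝕜 n π) :
    ℝ≥0∞ :=
  riceCond (fun B C : leftDomain 𝕜 n π => ‖(B : Matrix (Fin m) (Fin n) 𝕜) - C‖) s.dist
    (leftMap π) A

/-- The expression `1 / |x - y| * √((x² + y²) / (x + y)²)` for two singular values `x ≠ y`. -/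
noncomputable def inverseGap (x y : ℝ) : ℝ :=
  1 / |x - y| * √((x ^ 2 + y ^ 2) / (x + y) ^ 2)

/-- The `p × p` matrix `e_k e_lᵀ` (positions are numbered from `0`). -/
def unitMat (𝕜 : Type*) [RCLike 𝕜] (p k l : ℕ) : Matrix (Fin p) (Fin p) 𝕜 :=
  Matrix.of fun a b => if a.val = k ∧ b.val = l then 1 else 0

/-- The perturbation `U (e_j e_iᵀ - e_i e_jᵀ) Σ Vᴴ`, to which
`2 σ_i σ_j / (σ_i² + σ_j²) U Σ (e_i e_jᵀ - e_j e_iᵀ) Vᴴ` is added if `i` and `j` are both among the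
first `r` positions. -/
noncomputable def worstDirection {m n : ℕ} (r : ℕ) (U : Matrix (Fin m) (Fin m) 𝕜)
    (σ : Fin m → ℝ) (V : Matrix (Fin n) (Fin n) 𝕜) (i j : Fin m) : Matrix (Fin m) (Fin n) 𝕜 :=
  U * (unitMat 𝕜 m j i - unitMat 𝕜 m i j) * rectDiag 𝕜 n σ * Vᴴ +
    if i.val < r ∧ j.val < r then
      (2 * (σ i * σ j / (σ i ^ 2 + σ j ^ 2))) •
        (U * rectDiag 𝕜 n σ * (unitMat 𝕜 n i j - unitMat 𝕜 n j i) * Vᴴ)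
    else 0

end Definitions

end SingularSubspace

/-!
In the basis `U` of left singular vectors, `A * Aᴴ` is the diagonal matrix `S` of the `σ k ^ 2` and
the projector onto the vectors at the positions in `π` is a diagonal `0`-`1` matrix `D`. For a
nearby `B` let `S + Q` and `D + T` be the matrices of `B * Bᴴ` and of its projector. They commute,
so that `[S, T] = [D, Q] + [T, Q]`, and `D + T` is idempotent, so that `T = D T + T D + T ^ 2`.
Hence `T` agrees, up to terms of second order, with the matrix `firstOrder`, whose entry at `(a, b)`
is `± Q a b / (σ a ^ 2 - σ b ^ 2)` if exactly one of `a`, `b` lies in `π`, and `0` otherwise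
(`norm_sub_firstOrder_le`). That `T` itself is of first order (`norm_colProj_sub_le`) follows from
Weyl's inequality (`weyl_abs`), which keeps the singular values at the positions in `π` away from
the others. It also shows that all matrices near `A` belong to the domain, and that the projector
does not depend on the chosen decomposition.

With `L` the matrix of `E = B - A` in the bases `U`, `V`, the first order part of `Q a b` is
`L a b * σ b + star (L b a) * σ a`. By Cauchy-Schwarz, the norm of `firstOrder` is at most
`√2 κ ‖E‖`, where `κ` is the maximum of `inverseGap` (`IsFullSVD.sq_norm_firstOrder_le`). The worst
direction `A'` has the entries of `L` at `(j, i)` and `(i, j)` in the ratio `σ i : σ j`, the case of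
equality: there `κ * ‖A'‖ ≤ 1`, while `firstOrder` has the entries `1` at `(i, j)` and `(j, i)`
(`IsFullSVD.le_norm_firstOrder_worstDirection`).

The chordal distance is the Frobenius distance of the projectors divided by `√2`
(`sum_sin_principalAngle_sq`), and the other two distances agree with it up to a factor that tends
to `1` (`GrMetric.le_dist`, `GrMetric.dist_le`). So the difference quotients are at most `κ + o(1)`
everywhere near `A` and at least `κ - o(1)` along `A'`, which gives both the condition number `κ`
and its attainment.
-/

namespace SingularSubspace

variable {𝕜 : Type*} [RCLike 𝕜]

/-! ### The Frobenius norm -/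

theorem frobenius_sq {p q : ℕ} (M : Matrix (Fin p) (Fin q) 𝕜) :
    ‖M‖ ^ 2 = ∑ a, ∑ b, ‖M a b‖ ^ 2 := by
  have h : 0 ≤ ∑ a, ∑ b, ‖M a b‖ ^ 2 := by positivity
  rw [Matrix.frobenius_norm_def, ← Real.sqrt_eq_rpow]
  simp only [Real.rpow_two]
  exact Real.sq_sqrt h

theorem frobenius_sq_eq_trace {p q : ℕ} (M : Matrix (Fin p) (Fin q) 𝕜) :
    ‖M‖ ^ 2 = RCLike.re (Mᴴ * M).trace := by
  rw [frobenius_sq, Finset.sum_comm]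
  simp only [Matrix.trace, Matrix.diag_apply, Matrix.mul_apply, map_sum,
    Matrix.conjTranspose_apply, RCLike.star_def, RCLike.conj_mul]
  norm_cast

theorem norm_entry_le {p q : ℕ} (M : Matrix (Fin p) (Fin q) 𝕜) (a : Fin p) (b : Fin q) :
    ‖M a b‖ ≤ ‖M‖ := by
  refine le_of_sq_le_sq ?_ (norm_nonneg _)
  rw [frobenius_sq]
  refine le_trans ?_ (Finset.single_le_sum (f := fun a => ∑ b, ‖M a b‖ ^ 2)
    (fun _ _ => by positivity) (Finset.mem_univ a))
  exact Finset.single_le_sum (f := fun b => ‖M a b‖ ^ 2) (fun _ _ => by positivity)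
    (Finset.mem_univ b)

theorem frobenius_le_of_entry_le {p q : ℕ} {M N : Matrix (Fin p) (Fin q) 𝕜} {c : ℝ} (hc : 0 ≤ c)
    (h : ∀ a b, ‖M a b‖ ≤ c * ‖N a b‖) : ‖M‖ ≤ c * ‖N‖ := by
  refine le_of_sq_le_sq ?_ (by positivity)
  rw [mul_pow, frobenius_sq, frobenius_sq, Finset.mul_sum]
  gcongr with a
  rw [Finset.mul_sum]
  gcongr with b
  rw [← mul_pow]
  exact pow_le_pow_left₀ (norm_nonneg _) (h a b) 2

theorem frobenius_le_of_forall_le {p q : ℕ} {M : Matrix (Fin p) (Fin q) 𝕜} {c : ℝ} (hc : 0 ≤ c)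
    (h : ∀ a b, ‖M a b‖ ≤ c) : ‖M‖ ≤ p * q * c := by
  refine le_of_sq_le_sq ?_ (by positivity)
  have h1 : ‖M‖ ^ 2 ≤ p * q * c ^ 2 := by
    rw [frobenius_sq]
    refine (Finset.sum_le_sum fun a _ => Finset.sum_le_sum fun b _ =>
      pow_le_pow_left₀ (norm_nonneg _) (h a b) 2).trans ?_
    simp [mul_assoc]
  refine h1.trans ?_
  have h2 : ((p * q : ℕ) : ℝ) ≤ ((p * q : ℕ) : ℝ) ^ 2 := by
    exact_mod_cast Nat.le_self_pow two_ne_zero (p * q)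
  push_cast at h2
  rw [mul_pow]
  gcongr

theorem frobenius_isometry_mul {p q l : ℕ} {U : Matrix (Fin l) (Fin p) 𝕜} (hU : Uᴴ * U = 1)
    (M : Matrix (Fin p) (Fin q) 𝕜) : ‖U * M‖ = ‖M‖ := by
  have h : ‖U * M‖ ^ 2 = ‖M‖ ^ 2 := by
    rw [frobenius_sq_eq_trace, frobenius_sq_eq_trace, Matrix.conjTranspose_mul, Matrix.mul_assoc,
      ← Matrix.mul_assoc Uᴴ, hU, Matrix.one_mul]
  exact (sq_eq_sq₀ (norm_nonneg _) (norm_nonneg _)).1 h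

theorem frobenius_mul_coisometry {p q l : ℕ} {V : Matrix (Fin q) (Fin l) 𝕜} (hV : V * Vᴴ = 1)
    (M : Matrix (Fin p) (Fin q) 𝕜) : ‖M * V‖ = ‖M‖ := by
  rw [← Matrix.frobenius_norm_conjTranspose (M * V), Matrix.conjTranspose_mul,
    frobenius_isometry_mul (by rwa [Matrix.conjTranspose_conjTranspose]),
    Matrix.frobenius_norm_conjTranspose]

/-! ### Weyl's inequality -/

/-- The span of the eigenvectors of the first matrix for `e 0, …, e k` and the span
of those of the second for `d k, d (k + 1), …` meet in a unit vector, on which the quadratic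
forms of the two matrices are `≥ e k` and `≤ d k`. -/
theorem weyl_le {m : ℕ} {U W : Matrix (Fin m) (Fin m) 𝕜} {d e : Fin m → ℝ}
    (hU : U ∈ Matrix.unitaryGroup (Fin m) 𝕜) (hW : W ∈ Matrix.unitaryGroup (Fin m) 𝕜)
    (hd : Antitone d) (he : Antitone e) (k : Fin m) :
    e k ≤ d k + ‖W * Matrix.diagonal (fun a => (e a : 𝕜)) * Wᴴ -
      U * Matrix.diagonal (fun a => (d a : 𝕜)) * Uᴴ‖ := by
  set De : Matrix (Fin m) (Fin m) 𝕜 := Matrix.diagonal (fun a => (e a : 𝕜)) with hDe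
  set Dd : Matrix (Fin m) (Fin m) 𝕜 := Matrix.diagonal (fun a => (d a : 𝕜)) with hDd
  set R := W * De * Wᴴ - U * Dd * Uᴴ with hR
  have hU1 : U * Uᴴ = 1 := Matrix.mem_unitaryGroup_iff.1 hU
  have hW2 : Wᴴ * W = 1 := Matrix.mem_unitaryGroup_iff'.1 hW
  -- The rows of `C` force `W y` into the two spans; as the row at `k` vanishes, `y ≠ 0` exists.
  set C : Matrix (Fin m) (Fin m) 𝕜 := Matrix.of fun a b =>
    if a < k then (Uᴴ * W) a b else if k < a then (1 : Matrix (Fin m) (Fin m) 𝕜) a b else 0 with hC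
  have hdet : C.det = 0 := Matrix.det_eq_zero_of_row_eq_zero k (fun b => by simp [hC])
  obtain ⟨y, hy0, hy⟩ := Matrix.exists_mulVec_eq_zero_iff.2 hdet
  set Y : Matrix (Fin m) (Fin 1) 𝕜 := Matrix.of fun a _ => y a with hY
  set Z := Uᴴ * W * Y with hZ
  have hYhi : ∀ a, k < a → Y a 0 = 0 := fun a ha => by
    have := congrFun hy a
    simpa [hC, hY, Matrix.mulVec, dotProduct, ha, not_lt.2 ha.le, Matrix.one_apply] using this
  have hZlo : ∀ a, a < k → Z a 0 = 0 := fun a ha => by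
    have := congrFun hy a
    simpa [hC, Matrix.mulVec, dotProduct, ha, hZ, hY, Matrix.mul_apply (M := Uᴴ * W)] using this
  have hnorm : ‖Z‖ = ‖Y‖ := by
    refine frobenius_isometry_mul ?_ Y
    rw [Matrix.conjTranspose_mul, Matrix.conjTranspose_conjTranspose, Matrix.mul_assoc,
      ← Matrix.mul_assoc U, hU1, Matrix.one_mul, hW2]
  have hYpos : 0 < ‖Y‖ := by
    rw [norm_pos_iff]
    intro h
    exact hy0 (funext fun a => by simpa [hY] using congrFun (congrFun h a) 0)
  have hquad : ∀ (f : Fin m → ℝ) (X : Matrix (Fin m) (Fin 1) 𝕜),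
      RCLike.re ((Xᴴ * Matrix.diagonal (fun a => (f a : 𝕜)) * X) 0 0) =
        ∑ a, f a * ‖X a 0‖ ^ 2 := fun f X => by
    rw [Matrix.mul_apply]
    simp only [Matrix.mul_diagonal, map_sum, Matrix.conjTranspose_apply]
    refine Finset.sum_congr rfl fun a _ => ?_
    rw [mul_right_comm, RCLike.star_def, RCLike.conj_mul, mul_comm]
    norm_cast
  have hsq : ∀ X : Matrix (Fin m) (Fin 1) 𝕜, ‖X‖ ^ 2 = ∑ a, ‖X a 0‖ ^ 2 := fun X => by
    simp [frobenius_sq]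
  have h1 : e k * ‖Y‖ ^ 2 ≤ ∑ a, e a * ‖Y a 0‖ ^ 2 := by
    rw [hsq, Finset.mul_sum]
    refine Finset.sum_le_sum fun a _ => ?_
    rcases le_or_gt a k with h | h
    · exact mul_le_mul_of_nonneg_right (he h) (by positivity)
    · simp [hYhi a h]
  have h2 : ∑ a, d a * ‖Z a 0‖ ^ 2 ≤ d k * ‖Y‖ ^ 2 := by
    rw [← hnorm, hsq, Finset.mul_sum]
    refine Finset.sum_le_sum fun a _ => ?_
    rcases le_or_gt k a with h | h
    · exact mul_le_mul_of_nonneg_right (hd h) (by positivity)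
    · simp [hZlo a h]
  have h3 : Yᴴ * De * Y - Zᴴ * Dd * Z = (W * Y)ᴴ * R * (W * Y) := by
    have e1 : (W * Y)ᴴ * (W * De * Wᴴ) * (W * Y) = Yᴴ * (Wᴴ * W) * De * (Wᴴ * W) * Y := by
      simp only [Matrix.conjTranspose_mul, Matrix.mul_assoc]
    rw [hR, Matrix.mul_sub, Matrix.sub_mul, e1, hW2, hZ]
    simp only [Matrix.conjTranspose_mul, Matrix.mul_assoc, Matrix.conjTranspose_conjTranspose,
      Matrix.one_mul]
  have h4 : ∑ a, e a * ‖Y a 0‖ ^ 2 - ∑ a, d a * ‖Z a 0‖ ^ 2 ≤ ‖R‖ * ‖Y‖ ^ 2 := by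
    rw [← hquad, ← hquad, ← map_sub, ← Matrix.sub_apply, h3]
    have hWY : ‖W * Y‖ = ‖Y‖ := frobenius_isometry_mul hW2 Y
    calc _ ≤ ‖((W * Y)ᴴ * R * (W * Y)) 0 0‖ := RCLike.re_le_norm _
      _ ≤ ‖(W * Y)ᴴ * R * (W * Y)‖ := norm_entry_le _ _ _
      _ ≤ ‖(W * Y)ᴴ‖ * ‖R‖ * ‖W * Y‖ := (Matrix.frobenius_norm_mul _ _).trans
          (by gcongr; exact Matrix.frobenius_norm_mul _ _)
      _ = ‖R‖ * ‖Y‖ ^ 2 := by rw [Matrix.frobenius_norm_conjTranspose, hWY]; ring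
  have h5 : e k * ‖Y‖ ^ 2 ≤ (d k + ‖R‖) * ‖Y‖ ^ 2 := by linarith
  exact le_of_mul_le_mul_right h5 (by positivity)

/-- **Weyl's inequality** for the ordered eigenvalues of two Hermitian matrices. -/
theorem weyl_abs {m : ℕ} {U W : Matrix (Fin m) (Fin m) 𝕜} {d e : Fin m → ℝ}
    (hU : U ∈ Matrix.unitaryGroup (Fin m) 𝕜) (hW : W ∈ Matrix.unitaryGroup (Fin m) 𝕜)
    (hd : Antitone d) (he : Antitone e) (k : Fin m) :
    |e k - d k| ≤ ‖W * Matrix.diagonal (fun a => (e a : 𝕜)) * Wᴴ -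
      U * Matrix.diagonal (fun a => (d a : 𝕜)) * Uᴴ‖ := by
  have h1 := weyl_le hU hW hd he k
  have h2 := weyl_le hW hU he hd k
  rw [norm_sub_rev] at h2
  rw [abs_le]
  constructor <;> linarith

/-! ### Full singular value decompositions -/

theorem rectDiag_mul_conjTranspose {m n : ℕ} {σ : Fin m → ℝ}
    (h : ∀ k : Fin m, n ≤ k.val → σ k = 0) :
    rectDiag 𝕜 n σ * (rectDiag 𝕜 n σ)ᴴ = Matrix.diagonal (fun k => ((σ k ^ 2 : ℝ) : 𝕜)) := by
  ext a b
  rw [Matrix.mul_apply, Matrix.diagonal_apply]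
  by_cases ha : a.val < n
  · rw [Finset.sum_eq_single (⟨a.val, ha⟩ : Fin n)]
    · by_cases hab : a = b
      · subst hab
        simp [rectDiag, sq]
      · have : b.val ≠ a.val := fun h => hab (Fin.ext h.symm)
        simp [rectDiag, hab, this]
    · intro c _ hc
      have : a.val ≠ c.val := fun h => hc (Fin.ext h.symm)
      simp [rectDiag, this]
    · simp
  · have h0 := h a (not_lt.1 ha)
    rw [Finset.sum_eq_zero]
    · simp [h0]
    · intro c _
      simp [rectDiag, h0]

theorem range_selectedCols {𝕜 : Type*} [RCLike 𝕜] {m : ℕ} (π : Finset (Fin m))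
    (U : Matrix (Fin m) (Fin m) 𝕜) :
    Set.range (selectedCols π U).col = U.col '' π := by
  rw [← Finset.range_orderEmbOfFin π rfl, ← Set.range_comp]
  rfl

section SVD

variable {m n : ℕ} {A : Matrix (Fin m) (Fin n) 𝕜} {U : Matrix (Fin m) (Fin m) 𝕜} {σ : Fin m → ℝ}
  {V : Matrix (Fin n) (Fin n) 𝕜}

theorem conjTranspose_mul_self_of_unitary (hU : U ∈ Matrix.unitaryGroup (Fin m) 𝕜) : Uᴴ * U = 1 :=
  Matrix.mem_unitaryGroup_iff'.1 hU

theorem mul_conjTranspose_self_of_unitary (hU : U ∈ Matrix.unitaryGroup (Fin m) 𝕜) : U * Uᴴ = 1 :=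
  Matrix.mem_unitaryGroup_iff.1 hU

theorem IsFullSVD.nonneg (h : IsFullSVD A U σ V) (k : Fin m) : 0 ≤ σ k := by
  rcases lt_or_ge k.val A.rank with hk | hk
  · exact (h.pos k hk).le
  · exact (h.zero k hk).ge

theorem IsFullSVD.eq_zero_of_le (h : IsFullSVD A U σ V) (k : Fin m) (hk : n ≤ k.val) : σ k = 0 :=
  h.zero k ((Matrix.rank_le_width A).trans hk)

theorem IsFullSVD.antitone_sq (h : IsFullSVD A U σ V) : Antitone fun k => σ k ^ 2 :=
  fun _ b hab => pow_le_pow_left₀ (h.nonneg b) (h.antitone hab) 2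

theorem IsFullSVD.mul_conjTranspose (h : IsFullSVD A U σ V) :
    A * Aᴴ = U * Matrix.diagonal (fun k => ((σ k ^ 2 : ℝ) : 𝕜)) * Uᴴ := by
  have hV := conjTranspose_mul_self_of_unitary h.unitary_right
  rw [← rectDiag_mul_conjTranspose h.eq_zero_of_le]
  conv_lhs => rw [h.eq]
  simp only [Matrix.conjTranspose_mul, Matrix.conjTranspose_conjTranspose, Matrix.mul_assoc]
  rw [← Matrix.mul_assoc Vᴴ, hV, Matrix.one_mul]

theorem IsFullSVD.conjTranspose_mul_eq (h : IsFullSVD A U σ V) :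
    Aᴴ * U = V * (rectDiag 𝕜 n σ)ᴴ := by
  have hU := conjTranspose_mul_self_of_unitary h.unitary_left
  conv_lhs => rw [h.eq]
  simp only [Matrix.conjTranspose_mul, Matrix.conjTranspose_conjTranspose, Matrix.mul_assoc, hU,
    Matrix.mul_one]

theorem IsFullSVD.coord_mulVec (h : IsFullSVD A U σ V) (x : Fin m → 𝕜) (k : Fin m) :
    (Uᴴ *ᵥ ((A * Aᴴ) *ᵥ x)) k = ((σ k ^ 2 : ℝ) : 𝕜) * (Uᴴ *ᵥ x) k := by
  have hU := conjTranspose_mul_self_of_unitary h.unitary_left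
  have h1 : Uᴴ * (U * Matrix.diagonal (fun k => ((σ k ^ 2 : ℝ) : 𝕜)) * Uᴴ) =
      Matrix.diagonal (fun k => ((σ k ^ 2 : ℝ) : 𝕜)) * Uᴴ := by
    rw [← Matrix.mul_assoc, ← Matrix.mul_assoc, hU, Matrix.one_mul]
  rw [h.mul_conjTranspose, Matrix.mulVec_mulVec, h1, ← Matrix.mulVec_mulVec,
    Matrix.mulVec_diagonal]

theorem coord_col (hU : U ∈ Matrix.unitaryGroup (Fin m) 𝕜) (a k : Fin m) :
    (Uᴴ *ᵥ U.col k) a = if a = k then 1 else 0 := by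
  have h := congrFun (congrFun (conjTranspose_mul_self_of_unitary hU) a) k
  rw [Matrix.one_apply] at h
  rw [← h]
  rfl

theorem IsFullSVD.col_mem_eigenspace (h : IsFullSVD A U σ V) (k : Fin m) :
    U.col k ∈ Module.End.eigenspace (Matrix.toLin' (A * Aᴴ)) ((σ k ^ 2 : ℝ) : 𝕜) := by
  have hU := conjTranspose_mul_self_of_unitary h.unitary_left
  rw [Module.End.mem_eigenspace_iff, Matrix.toLin'_apply]
  have h1 : (A * Aᴴ) * U = U * Matrix.diagonal (fun k => ((σ k ^ 2 : ℝ) : 𝕜)) := by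
    rw [h.mul_conjTranspose, Matrix.mul_assoc, hU, Matrix.mul_one]
  ext a
  have h2 := congrFun (congrFun h1 a) k
  rw [Matrix.mul_diagonal, mul_comm] at h2
  exact h2

theorem IsFullSVD.coord_eq_zero (h : IsFullSVD A U σ V) {s : ℝ} (hs : 0 ≤ s) {x : Fin m → 𝕜}
    (hx : x ∈ Module.End.eigenspace (Matrix.toLin' (A * Aᴴ)) ((s ^ 2 : ℝ) : 𝕜)) {k : Fin m}
    (hk : σ k ≠ s) : (Uᴴ *ᵥ x) k = 0 := by
  rw [Module.End.mem_eigenspace_iff, Matrix.toLin'_apply] at hx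
  have h1 := h.coord_mulVec x k
  rw [hx, Matrix.mulVec_smul, Pi.smul_apply, smul_eq_mul] at h1
  have h2 : σ k ^ 2 ≠ s ^ 2 := fun h2 => hk ((sq_eq_sq₀ (h.nonneg k) hs).1 h2)
  by_contra h3
  exact h2 (RCLike.ofReal_injective (K := 𝕜) (mul_right_cancel₀ h3 h1)).symm

theorem singVal_nonneg {p q : ℕ} (M : Matrix (Fin p) (Fin q) 𝕜) (k : ℕ) : 0 ≤ singVal M k :=
  LinearMap.singularValues_nonneg _ k

theorem toLin_adjoint_comp_self {p q : ℕ} (M : Matrix (Fin p) (Fin q) 𝕜) :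
    LinearMap.adjoint (Matrix.toEuclideanLin M) ∘ₗ Matrix.toEuclideanLin M =
      Matrix.toEuclideanLin (Mᴴ * M) := by
  rw [← Matrix.toEuclideanLin_conjTranspose_eq_adjoint]
  ext x
  simp [Matrix.toLpLin_apply, Matrix.mulVec_mulVec]

/-- Every diagonal entry of a full singular value decomposition is among the singular values; `0`
always is, because `singVal` vanishes from the index `n` on. -/
theorem IsFullSVD.mem_range_singVal (h : IsFullSVD A U σ V) (k : Fin m) :
    σ k ∈ Set.range (singVal A) := by
  rcases eq_or_ne (σ k) 0 with h0 | h0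
  · refine ⟨n, ?_⟩
    rw [h0]
    exact LinearMap.singularValues_of_finrank_le _ (by simp)
  · have hkn : k.val < n := by
      by_contra hk
      exact h0 (h.eq_zero_of_le k (not_lt.1 hk))
    have hV := conjTranspose_mul_self_of_unitary h.unitary_right
    set T := Matrix.toEuclideanLin A with hT
    set v : EuclideanSpace 𝕜 (Fin n) := WithLp.toLp 2 (V.col ⟨k.val, hkn⟩) with hv
    have hv0 : v ≠ 0 := fun h0 => by
      have h1 := coord_col h.unitary_right ⟨k.val, hkn⟩ ⟨k.val, hkn⟩
      have h2 : V.col ⟨k.val, hkn⟩ = 0 := by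
        simpa [hv] using h0
      rw [h2] at h1
      simp at h1
    have hcol : (Aᴴ * A) *ᵥ V.col ⟨k.val, hkn⟩ = ((σ k ^ 2 : ℝ) : 𝕜) • V.col ⟨k.val, hkn⟩ := by
      have h1 : A * V = U * rectDiag 𝕜 n σ := by
        conv_lhs => rw [h.eq]
        rw [Matrix.mul_assoc, hV, Matrix.mul_one]
      have h2 : (Aᴴ * A) * V = V * ((rectDiag 𝕜 n σ)ᴴ * rectDiag 𝕜 n σ) := by
        rw [Matrix.mul_assoc, h1, ← Matrix.mul_assoc, h.conjTranspose_mul_eq, Matrix.mul_assoc]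
      have h3 : ∀ b : Fin n, ((rectDiag 𝕜 n σ)ᴴ * rectDiag 𝕜 n σ) b ⟨k.val, hkn⟩ =
          if b = ⟨k.val, hkn⟩ then ((σ k ^ 2 : ℝ) : 𝕜) else 0 := fun b => by
        rw [Matrix.mul_apply, Finset.sum_eq_single k]
        · by_cases hb : b = ⟨k.val, hkn⟩
          · subst hb
            simp [rectDiag, sq]
          · have : k.val ≠ b.val := fun h => hb (Fin.ext h.symm)
            simp [rectDiag, hb, this]
        · intro c _ hc
          have : c.val ≠ k.val := fun h => hc (Fin.ext h)
          simp [rectDiag, this]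
        · simp
      ext a
      have h4 := congrFun (congrFun h2 a) ⟨k.val, hkn⟩
      rw [Matrix.mul_apply (M := V)] at h4
      simp only [h3, mul_ite, mul_zero, Finset.sum_ite_eq', Finset.mem_univ, if_true] at h4
      rw [mul_comm] at h4
      exact h4
    have hev : Module.End.HasEigenvalue (LinearMap.adjoint T ∘ₗ T) ((σ k ^ 2 : ℝ) : 𝕜) := by
      refine Module.End.hasEigenvalue_of_hasEigenvector (x := v) ⟨?_, hv0⟩
      rw [Module.End.mem_eigenspace_iff, hT, toLin_adjoint_comp_self, Matrix.toLpLin_apply, hv]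
      simp only [hcol, WithLp.toLp_smul]
    obtain ⟨l, hl⟩ :=
      T.isSymmetric_adjoint_comp_self.exists_eigenvalues_eq finrank_euclideanSpace_fin hev
    refine ⟨l, ?_⟩
    have hl' := RCLike.ofReal_injective (K := 𝕜) hl
    have h5 := T.sq_singularValues_fin finrank_euclideanSpace_fin l
    rw [hl'] at h5
    exact (sq_eq_sq₀ (singVal_nonneg _ _) (h.nonneg k)).1 h5

/-- The singular values at the positions in `π` are different from the others, if the left singular
vectors at the positions in `π` span a left singular subspace. -/
theorem IsFullSVD.ne_of_isLeftSingularSubspace (h : IsFullSVD A U σ V) {π : Finset (Fin m)}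
    (hW : IsLeftSingularSubspace A (Submodule.span 𝕜 (Set.range (selectedCols π U).col)))
    {i j : Fin m} (hi : i ∈ π) (hj : j ∉ π) : σ i ≠ σ j := by
  intro hij
  obtain ⟨S, hS, hW⟩ := hW
  rw [range_selectedCols] at hW
  by_cases hjS : σ j ∈ S
  · -- the column at `j` lies in the span of the columns in `π`, to which it is orthogonal
    have h1 : U.col j ∈ Submodule.span 𝕜 (U.col '' π) := by
      rw [hW]
      exact Submodule.mem_iSup_of_mem (σ j) (Submodule.mem_iSup_of_mem hjS (h.col_mem_eigenspace j))
    have h2 : Submodule.span 𝕜 (U.col '' π) ≤ LinearMap.ker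
        (LinearMap.proj j ∘ₗ Matrix.mulVecLin Uᴴ) := by
      rw [Submodule.span_le]
      rintro _ ⟨k, hk, rfl⟩
      have hjk : j ≠ k := fun h => hj (h ▸ hk)
      simp [coord_col h.unitary_left, hjk]
    have h3 := h2 h1
    simp [coord_col h.unitary_left] at h3
  · -- the column at `i` is orthogonal to all the eigenspaces that make up the span
    have h1 : U.col i ∈ ⨆ s ∈ S, Module.End.eigenspace (Matrix.toLin' (A * Aᴴ))
        ((s ^ 2 : ℝ) : 𝕜) := by
      rw [← hW]
      exact Submodule.subset_span ⟨i, hi, rfl⟩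
    have h2 : (⨆ s ∈ S, Module.End.eigenspace (Matrix.toLin' (A * Aᴴ)) ((s ^ 2 : ℝ) : 𝕜)) ≤
        LinearMap.ker (LinearMap.proj i ∘ₗ Matrix.mulVecLin Uᴴ) := by
      refine iSup₂_le fun s hs x hx => ?_
      have hs0 : 0 ≤ s := by
        obtain ⟨l, rfl⟩ := hS hs
        exact singVal_nonneg _ _
      have hne : σ i ≠ s := fun hs' => hjS (hij ▸ hs' ▸ hs)
      simpa using h.coord_eq_zero hs0 hx hne
    have h3 := h2 h1
    simp [coord_col h.unitary_left] at h3

/-- The converse of `IsFullSVD.ne_of_isLeftSingularSubspace`. -/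
theorem IsFullSVD.isLeftSingularSubspace (h : IsFullSVD A U σ V) {π : Finset (Fin m)}
    (hne : ∀ i ∈ π, ∀ j ∉ π, σ i ≠ σ j) :
    IsLeftSingularSubspace A (Submodule.span 𝕜 (Set.range (selectedCols π U).col)) := by
  refine ⟨σ '' π, ?_, ?_⟩
  · rintro _ ⟨k, -, rfl⟩
    exact h.mem_range_singVal k
  · rw [range_selectedCols]
    apply le_antisymm
    · rw [Submodule.span_le]
      rintro _ ⟨k, hk, rfl⟩
      exact Submodule.mem_iSup_of_mem (σ k)
        (Submodule.mem_iSup_of_mem ⟨k, hk, rfl⟩ (h.col_mem_eigenspace k))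
    · refine iSup₂_le fun s hs x hx => ?_
      obtain ⟨k, hk, rfl⟩ := hs
      have hx' : x = ∑ a, (Uᴴ *ᵥ x) a • U.col a := by
        have h1 : U *ᵥ (Uᴴ *ᵥ x) = x := by
          rw [Matrix.mulVec_mulVec, mul_conjTranspose_self_of_unitary h.unitary_left,
            Matrix.one_mulVec]
        conv_lhs => rw [← h1]
        ext b
        simp [Matrix.mulVec, dotProduct, mul_comm]
      rw [hx']
      refine Submodule.sum_mem _ fun a _ => ?_
      by_cases ha : a ∈ π
      · exact Submodule.smul_mem _ _ (Submodule.subset_span ⟨a, ha, rfl⟩)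
      · rw [h.coord_eq_zero (h.nonneg k) hx (hne k hk a ha).symm, zero_smul]
        exact Submodule.zero_mem _

end SVD

/-! ### Existence of full singular value decompositions -/

theorem exists_antitone_diagonalization {m n : ℕ} (A : Matrix (Fin m) (Fin n) 𝕜) :
    ∃ U ∈ Matrix.unitaryGroup (Fin m) 𝕜, ∃ σ : Fin m → ℝ, Antitone σ ∧ (∀ k, 0 ≤ σ k) ∧
      (A * Aᴴ) * U = U * Matrix.diagonal (fun k => ((σ k ^ 2 : ℝ) : 𝕜)) := by
  set T := Matrix.toEuclideanLin Aᴴ with hT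
  have hT2 : LinearMap.adjoint T ∘ₗ T = Matrix.toEuclideanLin (A * Aᴴ) := by
    rw [hT, toLin_adjoint_comp_self, Matrix.conjTranspose_conjTranspose]
  have hn : Module.finrank 𝕜 (EuclideanSpace 𝕜 (Fin m)) = m := finrank_euclideanSpace_fin
  set b := T.isSymmetric_adjoint_comp_self.eigenvectorBasis hn with hb
  refine ⟨Matrix.of fun a k => b k a, ?_, fun k => T.singularValues k, ?_, ?_, ?_⟩
  · rw [Matrix.mem_unitaryGroup_iff']
    ext k l
    have h := orthonormal_iff_ite.1 b.orthonormal k l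
    rw [Matrix.one_apply, ← h, Matrix.mul_apply, PiLp.inner_apply]
    simp [mul_comm]
  · exact fun k l hkl => T.singularValues_antitone hkl
  · exact fun k => T.singularValues_nonneg k
  · ext a k
    have h := T.isSymmetric_adjoint_comp_self.apply_eigenvectorBasis hn k
    rw [← T.sq_singularValues_fin hn k] at h
    have h2 := congrArg (fun x : EuclideanSpace 𝕜 (Fin m) => x a)
      ((LinearMap.congr_fun hT2 (b k)).symm.trans h)
    rw [Matrix.mul_diagonal, mul_comm]
    simpa [Matrix.toLpLin_apply, Matrix.mulVec, dotProduct, Matrix.mul_apply (N := Matrix.of _)]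
      using h2

open scoped ComplexOrder in
theorem rank_eq_card_of_diagonalization {m n : ℕ} {A : Matrix (Fin m) (Fin n) 𝕜}
    {U : Matrix (Fin m) (Fin m) 𝕜} (hU : U ∈ Matrix.unitaryGroup (Fin m) 𝕜) {σ : Fin m → ℝ}
    (h : (A * Aᴴ) * U = U * Matrix.diagonal (fun k => ((σ k ^ 2 : ℝ) : 𝕜))) :
    A.rank = (Finset.univ.filter fun k => σ k ≠ 0).card := by
  have hdet : IsUnit U.det := by
    rw [← Matrix.isUnit_iff_isUnit_det]
    exact ⟨⟨U, Uᴴ, mul_conjTranspose_self_of_unitary hU, conjTranspose_mul_self_of_unitary hU⟩, rfl⟩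
  rw [← Matrix.rank_self_mul_conjTranspose A, ← Matrix.rank_mul_eq_left_of_isUnit_det U _ hdet, h,
    Matrix.rank_mul_eq_right_of_isUnit_det U _ hdet, Matrix.rank_diagonal, Fintype.card_subtype]
  congr 1
  ext k
  simp

theorem ne_zero_iff_lt_card {m : ℕ} {σ : Fin m → ℝ} (hσ : Antitone σ) (h0 : ∀ k, 0 ≤ σ k)
    (k : Fin m) :
    σ k ≠ 0 ↔ k.val < (Finset.univ.filter fun k => σ k ≠ 0).card := by
  constructor
  · intro hk
    have hsub : Finset.Iic k ⊆ Finset.univ.filter fun k => σ k ≠ 0 := fun a ha => by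
      have h1 := hσ (Finset.mem_Iic.1 ha)
      have h2 := lt_of_le_of_ne (h0 k) hk.symm
      simpa using (h2.trans_le h1).ne'
    have h3 := Finset.card_le_card hsub
    rw [Fin.card_Iic] at h3
    omega
  · intro hk hk0
    have hsub : (Finset.univ.filter fun k => σ k ≠ 0) ⊆ Finset.Iio k := fun a ha => by
      rw [Finset.mem_Iio]
      by_contra hle
      have h1 := hσ (not_lt.1 hle)
      exact (Finset.mem_filter.1 ha).2 (le_antisymm (hk0 ▸ h1) (h0 a))
    have h3 := Finset.card_le_card hsub
    rw [Fin.card_Iio] at h3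
    omega

/-- Existence of a full singular value decomposition: `U` and `σ` diagonalize `A * Aᴴ`, and the
columns of `Aᴴ * U` for the nonzero singular values, which are orthogonal, are normalized and
completed to an orthonormal basis. -/
theorem exists_isFullSVD {m n : ℕ} (A : Matrix (Fin m) (Fin n) 𝕜) :
    ∃ U σ V, IsFullSVD A U σ V := by
  obtain ⟨U, hU, σ, hσ, h0, h⟩ := exists_antitone_diagonalization A
  have hrank := rank_eq_card_of_diagonalization hU h
  have hiff : ∀ k : Fin m, σ k ≠ 0 ↔ k.val < A.rank := fun k => by
    rw [hrank]
    exact ne_zero_iff_lt_card hσ h0 k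
  have hlt : ∀ k : Fin m, σ k ≠ 0 → k.val < n := fun k hk =>
    ((hiff k).1 hk).trans_le (Matrix.rank_le_width A)
  have hUU := conjTranspose_mul_self_of_unitary hU
  set B := Aᴴ * U with hB
  have hBB : Bᴴ * B = Matrix.diagonal (fun k => ((σ k ^ 2 : ℝ) : 𝕜)) := by
    rw [hB, Matrix.conjTranspose_mul, Matrix.conjTranspose_conjTranspose, Matrix.mul_assoc,
      ← Matrix.mul_assoc A, h, ← Matrix.mul_assoc, hUU, Matrix.one_mul]
  have hBBe : ∀ k l : Fin m, ∑ c, star (B c k) * B c l =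
      if k = l then ((σ k ^ 2 : ℝ) : 𝕜) else 0 := fun k l => by
    have h1 := congrFun (congrFun hBB k) l
    rw [Matrix.mul_apply, Matrix.diagonal_apply] at h1
    exact h1
  -- The right singular vectors for the nonzero singular values are the normalized columns of `B`.
  set v : Fin n → EuclideanSpace 𝕜 (Fin n) := fun k =>
    if hk : k.val < m then WithLp.toLp 2 (fun a => ((σ ⟨k, hk⟩)⁻¹ : ℝ) * B a ⟨k, hk⟩) else 0 with hv
  set s : Set (Fin n) := {k | ∃ hk : k.val < m, σ ⟨k, hk⟩ ≠ 0} with hs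
  have horth : Orthonormal 𝕜 (s.domRestrict v) := by
    rw [orthonormal_iff_ite]
    rintro ⟨k, hk, hk0⟩ ⟨l, hl, hl0⟩
    have h1 := hBBe ⟨k, hk⟩ ⟨l, hl⟩
    have h2 : inner 𝕜 (v k) (v l) = ((σ ⟨k, hk⟩)⁻¹ : ℝ) * ((σ ⟨l, hl⟩)⁻¹ : ℝ) *
        ∑ c, star (B c ⟨k, hk⟩) * B c ⟨l, hl⟩ := by
      rw [PiLp.inner_apply, Finset.mul_sum]
      refine Finset.sum_congr rfl fun c _ => ?_
      simp only [hv, hk, hl, dif_pos, RCLike.inner_apply, map_mul, RCLike.conj_ofReal,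
        RCLike.star_def]
      ring
    refine h2.trans ?_
    rw [h1]
    by_cases hkl : k = l
    · subst hkl
      have : ((σ ⟨k, hk⟩ : ℝ) : 𝕜) ≠ 0 := by exact_mod_cast hk0
      simp only [if_true]
      push_cast
      field_simp
    · have h3 : (⟨k.val, hk⟩ : Fin m) ≠ ⟨l.val, hl⟩ := fun h => hkl (Fin.ext (Fin.mk.inj_iff.1 h))
      simp [hkl, h3]
  obtain ⟨b, hb⟩ := horth.exists_orthonormalBasis_extension_of_card_eq
    (by simp : Module.finrank 𝕜 (EuclideanSpace 𝕜 (Fin n)) = Fintype.card (Fin n))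
  set V : Matrix (Fin n) (Fin n) 𝕜 := Matrix.of fun a k => b k a with hVdef
  have hV : V ∈ Matrix.unitaryGroup (Fin n) 𝕜 := by
    rw [Matrix.mem_unitaryGroup_iff']
    ext k l
    have h := orthonormal_iff_ite.1 b.orthonormal k l
    rw [Matrix.one_apply, ← h, Matrix.mul_apply, PiLp.inner_apply]
    simp [hVdef, mul_comm]
  have hBV : B = V * (rectDiag 𝕜 n σ)ᴴ := by
    ext a k
    rw [Matrix.mul_apply]
    by_cases hk0 : σ k = 0
    · have h1 : B a k = 0 := by
        have h2 := hBBe k k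
        simp only [hk0, if_true, RCLike.star_def, RCLike.conj_mul] at h2
        have h3 : ∑ c, ‖B c k‖ ^ 2 = 0 := by
          have : ((∑ c, ‖B c k‖ ^ 2 : ℝ) : 𝕜) = 0 := by
            push_cast
            rw [h2]
            simp
          exact_mod_cast this
        have h4 := (Finset.sum_eq_zero_iff_of_nonneg (fun _ _ => by positivity)).1 h3 a
          (Finset.mem_univ a)
        simpa using h4
      rw [h1, Finset.sum_eq_zero]
      intro c _
      simp [rectDiag, hk0]
    · have hkn := hlt k hk0
      rw [Finset.sum_eq_single (⟨k.val, hkn⟩ : Fin n)]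
      · have h1 : b ⟨k.val, hkn⟩ = v ⟨k.val, hkn⟩ := hb _ ⟨k.isLt, hk0⟩
        have h2 : ((σ k : ℝ) : 𝕜) ≠ 0 := by exact_mod_cast hk0
        simp [rectDiag, hVdef, h1, hv]
        field_simp
      · intro c _ hc
        have : k.val ≠ c.val := fun h => hc (Fin.ext h.symm)
        simp [rectDiag, this]
      · simp
  refine ⟨U, σ, V, hU, hV, hσ, ?_, ?_, ?_⟩
  · exact fun k hk => lt_of_le_of_ne (h0 k) ((hiff k).2 hk).symm
  · intro k hk
    by_contra hne
    exact absurd ((hiff k).1 hne) (not_lt.2 hk)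
  · have h1 : A = U * Bᴴ := by
      rw [hB, Matrix.conjTranspose_mul, Matrix.conjTranspose_conjTranspose, ← Matrix.mul_assoc,
        mul_conjTranspose_self_of_unitary hU, Matrix.one_mul]
    rw [h1, hBV, Matrix.conjTranspose_mul, Matrix.conjTranspose_conjTranspose, Matrix.mul_assoc]

/-! ### Perturbation of the spectral projector -/

/-- The coordinate projector onto the positions in `π`. -/
def coordProj (𝕜 : Type*) [RCLike 𝕜] {m : ℕ} (π : Finset (Fin m)) : Matrix (Fin m) (Fin m) 𝕜 :=
  Matrix.diagonal fun k => if k ∈ π then 1 else 0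

/-- The orthogonal projector onto the span of the columns of `U` at the positions in `π`. -/
def colProj {m : ℕ} (π : Finset (Fin m)) (U : Matrix (Fin m) (Fin m) 𝕜) :
    Matrix (Fin m) (Fin m) 𝕜 :=
  selectedCols π U * (selectedCols π U)ᴴ

theorem colProj_eq {m : ℕ} (π : Finset (Fin m)) (U : Matrix (Fin m) (Fin m) 𝕜) :
    colProj π U = U * coordProj 𝕜 π * Uᴴ := by
  ext a b
  rw [colProj, Matrix.mul_apply, Matrix.mul_apply]
  simp only [coordProj, Matrix.mul_diagonal, Matrix.conjTranspose_apply, selectedCols,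
    Matrix.submatrix_apply, id, mul_ite, mul_one, mul_zero, ite_mul, zero_mul]
  rw [Finset.sum_ite_mem, Finset.univ_inter]
  conv_rhs => rw [← Finset.map_orderEmbOfFin_univ π rfl]
  rw [Finset.sum_map]
  rfl

theorem coordProj_mul_self {m : ℕ} (π : Finset (Fin m)) :
    coordProj 𝕜 π * coordProj 𝕜 π = coordProj 𝕜 π := by
  rw [coordProj, Matrix.diagonal_mul_diagonal]
  congr 1
  ext k
  simp

/-- The first order change, in the basis of the left singular vectors, of the projector onto the
left singular vectors at the positions in `π`, when `A * Aᴴ` changes by `N` (in that basis). -/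
noncomputable def firstOrder {m : ℕ} (π : Finset (Fin m)) (σ : Fin m → ℝ)
    (N : Matrix (Fin m) (Fin m) 𝕜) : Matrix (Fin m) (Fin m) 𝕜 :=
  Matrix.of fun a b => if (a ∈ π ↔ b ∈ π) then 0 else
    (if a ∈ π then 1 else -1) * N a b / ((σ a ^ 2 - σ b ^ 2 : ℝ) : 𝕜)

section

variable {m n : ℕ} {A B : Matrix (Fin m) (Fin n) 𝕜} {U U' : Matrix (Fin m) (Fin m) 𝕜}
  {σ σ' : Fin m → ℝ} {V V' : Matrix (Fin n) (Fin n) 𝕜}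

theorem norm_conj_unitary (hU : U ∈ Matrix.unitaryGroup (Fin m) 𝕜)
    (hU' : U' ∈ Matrix.unitaryGroup (Fin m) 𝕜) (M : Matrix (Fin m) (Fin m) 𝕜) :
    ‖Uᴴ * M * U'‖ = ‖M‖ := by
  rw [frobenius_mul_coisometry (mul_conjTranspose_self_of_unitary hU'), frobenius_isometry_mul]
  rw [Matrix.conjTranspose_conjTranspose, mul_conjTranspose_self_of_unitary hU]

/-- In the bases `U` and `U'`, with `X = Uᴴ * U'`, the entry of the difference of the projectors is
`± X a b` for `a` and `b` on different sides of `π` and `0` otherwise, while that of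
`B * Bᴴ - A * Aᴴ` is `X a b * (σ' b ^ 2 - σ a ^ 2)`. -/
theorem norm_colProj_sub_le (hA : IsFullSVD A U σ V) (hB : IsFullSVD B U' σ' V')
    {π : Finset (Fin m)} {g : ℝ} (hg : 0 < g)
    (hgap : ∀ a b, ¬(a ∈ π ↔ b ∈ π) → g ≤ |σ' b ^ 2 - σ a ^ 2|) :
    ‖colProj π U' - colProj π U‖ ≤ g⁻¹ * ‖B * Bᴴ - A * Aᴴ‖ := by
  have hU := conjTranspose_mul_self_of_unitary hA.unitary_left
  have hU' := conjTranspose_mul_self_of_unitary hB.unitary_left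
  have key : ∀ D D' : Matrix (Fin m) (Fin m) 𝕜,
      Uᴴ * (U' * D' * U'ᴴ - U * D * Uᴴ) * U' = Uᴴ * U' * D' - D * (Uᴴ * U') := fun D D' => by
    have e1 : Uᴴ * (U' * D' * U'ᴴ - U * D * Uᴴ) * U' =
        Uᴴ * U' * D' * (U'ᴴ * U') - (Uᴴ * U) * D * (Uᴴ * U') := by
      rw [Matrix.mul_sub, Matrix.sub_mul]
      simp only [Matrix.mul_assoc]
    rw [e1, hU, hU', Matrix.mul_one, Matrix.one_mul]
  rw [← norm_conj_unitary hA.unitary_left hB.unitary_left (colProj π U' - colProj π U),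
    ← norm_conj_unitary hA.unitary_left hB.unitary_left (B * Bᴴ - A * Aᴴ),
    colProj_eq, colProj_eq, hA.mul_conjTranspose, hB.mul_conjTranspose, key, key]
  set X := Uᴴ * U'
  refine frobenius_le_of_entry_le (by positivity) fun a b => ?_
  simp only [coordProj, Matrix.sub_apply, Matrix.mul_diagonal, Matrix.diagonal_mul]
  have e2 : X a b * ((σ' b ^ 2 : ℝ) : 𝕜) - ((σ a ^ 2 : ℝ) : 𝕜) * X a b =
      ((σ' b ^ 2 - σ a ^ 2 : ℝ) : 𝕜) * X a b := by
    push_cast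
    ring
  rw [e2, norm_mul, RCLike.norm_ofReal]
  by_cases hab : a ∈ π ↔ b ∈ π
  · by_cases ha : a ∈ π
    · have hb := hab.1 ha
      simp only [ha, hb, if_true, mul_one, one_mul, sub_self, norm_zero]
      positivity
    · have hb : b ∉ π := fun hb => ha (hab.2 hb)
      simp only [ha, hb, if_false, mul_zero, zero_mul, sub_self, norm_zero]
      positivity
  · have h1 : ‖X a b * (if b ∈ π then 1 else 0) - (if a ∈ π then 1 else 0) * X a b‖ =
        ‖X a b‖ := by
      by_cases ha : a ∈ π <;> by_cases hb : b ∈ π <;> simp_all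
    rw [h1, ← mul_assoc]
    have h2 : 1 ≤ g⁻¹ * |σ' b ^ 2 - σ a ^ 2| := by
      rw [inv_mul_eq_div, one_le_div hg]
      exact hgap a b hab
    exact le_mul_of_one_le_left (norm_nonneg _) h2

theorem gram_sub_eq (A B : Matrix (Fin m) (Fin n) 𝕜) :
    B * Bᴴ - A * Aᴴ = (B - A) * Aᴴ + A * (B - A)ᴴ + (B - A) * (B - A)ᴴ := by
  simp only [Matrix.conjTranspose_sub, Matrix.sub_mul, Matrix.mul_sub]
  abel

/-- If the idempotent `D + T` commutes with `S + Q`, where `D` is idempotent and commutes with `S`,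
then `[S, T] = [D, Q] + [T, Q]` and `T = D T + T D + T ^ 2`. -/
theorem commutator_identities {R : Type*} [Ring R] {D T S Q : R} (hDS : D * S = S * D)
    (hDD : D * D = D) (hcomm : (D + T) * (S + Q) = (S + Q) * (D + T))
    (hidem : (D + T) * (D + T) = D + T) :
    S * T - T * S = D * Q - Q * D + (T * Q - Q * T) ∧ T = D * T + T * D + T * T := by
  simp only [add_mul, mul_add, hDS] at hcomm
  simp only [add_mul, mul_add, hDD] at hidem
  constructor
  · linear_combination (norm := abel) -hcomm
  · linear_combination (norm := abel) -hidem

/-- The commutator identity gives the entries of `T` on different sides of `π`; the other entries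
are, up to sign, those of `T * T`. -/
theorem norm_sub_firstOrder_le_of_commutator {π : Finset (Fin m)} {g : ℝ} (hg : 0 < g)
    (hgap : ∀ a b, ¬(a ∈ π ↔ b ∈ π) → g ≤ |σ a ^ 2 - σ b ^ 2|)
    {T Q N G : Matrix (Fin m) (Fin m) 𝕜} (hQNG : Q = N + G)
    (h1 : Matrix.diagonal (fun k => ((σ k ^ 2 : ℝ) : 𝕜)) * T -
      T * Matrix.diagonal (fun k => ((σ k ^ 2 : ℝ) : 𝕜)) =
        coordProj 𝕜 π * Q - Q * coordProj 𝕜 π + (T * Q - Q * T))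
    (h2 : T = coordProj 𝕜 π * T + T * coordProj 𝕜 π + T * T) :
    ‖T - firstOrder π σ N‖ ≤ m * m * (g⁻¹ * (‖G‖ + 2 * ‖T‖ * ‖Q‖) + ‖T‖ ^ 2) := by
  have hTQ : ‖T * Q - Q * T‖ ≤ 2 * ‖T‖ * ‖Q‖ := by
    calc ‖T * Q - Q * T‖ ≤ ‖T * Q‖ + ‖Q * T‖ := norm_sub_le _ _
      _ ≤ ‖T‖ * ‖Q‖ + ‖Q‖ * ‖T‖ := add_le_add (Matrix.frobenius_norm_mul _ _)
          (Matrix.frobenius_norm_mul _ _)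
      _ = 2 * ‖T‖ * ‖Q‖ := by ring
  refine frobenius_le_of_forall_le (by positivity) fun a b => ?_
  by_cases hab : a ∈ π ↔ b ∈ π
  · have h3 := congrFun (congrFun h2 a) b
    have h4 : ‖T a b‖ = ‖(T * T) a b‖ := by
      rw [Matrix.add_apply, Matrix.add_apply, coordProj, Matrix.mul_diagonal,
        Matrix.diagonal_mul] at h3
      by_cases ha : a ∈ π
      · rw [if_pos ha, if_pos (hab.1 ha), mul_one, one_mul] at h3
        rw [← norm_neg]
        congr 1
        linear_combination h3
      · rw [if_neg ha, if_neg fun hb => ha (hab.2 hb), mul_zero, zero_mul, zero_add,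
          zero_add] at h3
        rw [← h3]
    have h5 : ‖(T * T) a b‖ ≤ ‖T‖ ^ 2 := by
      rw [sq]
      exact (norm_entry_le _ _ _).trans (Matrix.frobenius_norm_mul _ _)
    have h6 : (T - firstOrder π σ N) a b = T a b := by
      rw [Matrix.sub_apply, firstOrder, Matrix.of_apply, if_pos hab, sub_zero]
    rw [h6, h4]
    exact h5.trans (le_add_of_nonneg_left (by positivity))
  · have hgab := hgap a b hab
    have hne : ((σ a ^ 2 - σ b ^ 2 : ℝ) : 𝕜) ≠ 0 := by
      intro h0
      rw [RCLike.ofReal_eq_zero] at h0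
      rw [h0, abs_zero] at hgab
      linarith
    have h3 := congrFun (congrFun h1 a) b
    obtain ⟨s, hs⟩ : ∃ s : 𝕜, s = if a ∈ π then 1 else -1 := ⟨_, rfl⟩
    have hsn : ‖s‖ = 1 := by
      rw [hs]
      split_ifs <;> simp
    have h4 : ((σ a ^ 2 - σ b ^ 2 : ℝ) : 𝕜) * T a b = s * Q a b + (T * Q - Q * T) a b := by
      rw [Matrix.add_apply, Matrix.sub_apply, Matrix.sub_apply (coordProj 𝕜 π * Q), coordProj,
        Matrix.mul_diagonal, Matrix.diagonal_mul, Matrix.mul_diagonal, Matrix.diagonal_mul] at h3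
      have h5 : s = (if a ∈ π then 1 else 0) - (if b ∈ π then 1 else 0) := by
        rw [hs]
        by_cases ha : a ∈ π <;> by_cases hb : b ∈ π <;> simp [ha, hb] at hab ⊢
      rw [h5]
      push_cast at h3 ⊢
      linear_combination h3
    have h6 : firstOrder π σ N a b = s * N a b / ((σ a ^ 2 - σ b ^ 2 : ℝ) : 𝕜) := by
      rw [firstOrder, Matrix.of_apply, if_neg hab, hs]
    have h5 : (T - firstOrder π σ N) a b =
        (s * G a b + (T * Q - Q * T) a b) / ((σ a ^ 2 - σ b ^ 2 : ℝ) : 𝕜) := by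
      have h8 : Q a b = N a b + G a b := by rw [hQNG, Matrix.add_apply]
      rw [Matrix.sub_apply, h6, eq_div_iff hne, sub_mul, div_mul_cancel₀ _ hne, mul_comm, h4, h8]
      ring
    have h7 : ‖s * G a b + (T * Q - Q * T) a b‖ ≤ ‖G‖ + 2 * ‖T‖ * ‖Q‖ := by
      refine (norm_add_le _ _).trans (add_le_add ?_ ((norm_entry_le _ _ _).trans hTQ))
      rw [norm_mul, hsn, one_mul]
      exact norm_entry_le _ _ _
    rw [h5, norm_div, RCLike.norm_ofReal]
    calc _ ≤ (‖G‖ + 2 * ‖T‖ * ‖Q‖) / g := by gcongr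
      _ ≤ _ := by
        rw [div_eq_inv_mul]
        exact le_add_of_nonneg_right (by positivity)

/-- Up to a remainder of second order, the projector changes by `firstOrder`. -/
theorem norm_sub_firstOrder_le (hA : IsFullSVD A U σ V) (hB : IsFullSVD B U' σ' V')
    {π : Finset (Fin m)} {g : ℝ} (hg : 0 < g)
    (hgap : ∀ a b, ¬(a ∈ π ↔ b ∈ π) → g ≤ |σ a ^ 2 - σ b ^ 2|) :
    ‖Uᴴ * (colProj π U' - colProj π U) * U -
        firstOrder π σ (Uᴴ * ((B - A) * Aᴴ + A * (B - A)ᴴ) * U)‖ ≤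
      m * m * (g⁻¹ * (‖B - A‖ ^ 2 + 2 * ‖colProj π U' - colProj π U‖ * ‖B * Bᴴ - A * Aᴴ‖) +
        ‖colProj π U' - colProj π U‖ ^ 2) := by
  have hU := conjTranspose_mul_self_of_unitary hA.unitary_left
  have hUr := mul_conjTranspose_self_of_unitary hA.unitary_left
  have hU' := conjTranspose_mul_self_of_unitary hB.unitary_left
  have hmul : ∀ M M' : Matrix (Fin m) (Fin m) 𝕜,
      (Uᴴ * M * U) * (Uᴴ * M' * U) = Uᴴ * (M * M') * U := fun M M' => by
    have : (Uᴴ * M * U) * (Uᴴ * M' * U) = Uᴴ * M * (U * Uᴴ) * M' * U := by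
      simp only [Matrix.mul_assoc]
    rw [this, hUr, Matrix.mul_one]
    simp only [Matrix.mul_assoc]
  have hmul' : ∀ M M' : Matrix (Fin m) (Fin m) 𝕜,
      (U' * M * U'ᴴ) * (U' * M' * U'ᴴ) = U' * (M * M') * U'ᴴ := fun M M' => by
    have : (U' * M * U'ᴴ) * (U' * M' * U'ᴴ) = U' * M * (U'ᴴ * U') * M' * U'ᴴ := by
      simp only [Matrix.mul_assoc]
    rw [this, hU', Matrix.mul_one]
    simp only [Matrix.mul_assoc]
  have hcancel : ∀ M : Matrix (Fin m) (Fin m) 𝕜, Uᴴ * (U * M * Uᴴ) * U = M := fun M => by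
    have : Uᴴ * (U * M * Uᴴ) * U = (Uᴴ * U) * M * (Uᴴ * U) := by
      simp only [Matrix.mul_assoc]
    rw [this, hU, Matrix.one_mul, Matrix.mul_one]
  have hdiff : ∀ M M' : Matrix (Fin m) (Fin m) 𝕜,
      M + Uᴴ * (M' - U * M * Uᴴ) * U = Uᴴ * M' * U := fun M M' => by
    rw [Matrix.mul_sub, Matrix.sub_mul, hcancel]
    abel
  have hdiag : ∀ f : Fin m → 𝕜, coordProj 𝕜 π * Matrix.diagonal f =
      Matrix.diagonal f * coordProj 𝕜 π := fun f => by
    rw [coordProj, Matrix.diagonal_mul_diagonal, Matrix.diagonal_mul_diagonal]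
    simp only [mul_comm]
  have hDT := hdiff (coordProj 𝕜 π) (colProj π U')
  rw [← colProj_eq] at hDT
  have hSQ := hdiff (Matrix.diagonal (fun k => ((σ k ^ 2 : ℝ) : 𝕜))) (B * Bᴴ)
  rw [← hA.mul_conjTranspose] at hSQ
  obtain ⟨h1, h2⟩ := commutator_identities (hdiag _) (coordProj_mul_self π)
    (T := Uᴴ * (colProj π U' - colProj π U) * U) (Q := Uᴴ * (B * Bᴴ - A * Aᴴ) * U)
    (S := Matrix.diagonal (fun k => ((σ k ^ 2 : ℝ) : 𝕜)))
    (by rw [hDT, hSQ, hmul, hmul, colProj_eq, hB.mul_conjTranspose, hmul', hmul', hdiag])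
    (by rw [hDT, hmul, colProj_eq, hmul', coordProj_mul_self])
  have hQNG : Uᴴ * (B * Bᴴ - A * Aᴴ) * U = Uᴴ * ((B - A) * Aᴴ + A * (B - A)ᴴ) * U +
      Uᴴ * ((B - A) * (B - A)ᴴ) * U := by
    rw [← Matrix.add_mul, ← Matrix.mul_add, gram_sub_eq]
  refine (norm_sub_firstOrder_le_of_commutator hg hgap hQNG h1 h2).trans ?_
  rw [norm_conj_unitary hA.unitary_left hA.unitary_left,
    norm_conj_unitary hA.unitary_left hA.unitary_left,
    norm_conj_unitary hA.unitary_left hA.unitary_left]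
  have hGn : ‖(B - A) * (B - A)ᴴ‖ ≤ ‖B - A‖ ^ 2 := by
    refine (Matrix.frobenius_norm_mul _ _).trans ?_
    rw [Matrix.frobenius_norm_conjTranspose, sq]
  gcongr

theorem norm_gram_sub_le (A B : Matrix (Fin m) (Fin n) 𝕜) (h : ‖B - A‖ ≤ 1) :
    ‖B * Bᴴ - A * Aᴴ‖ ≤ (2 * ‖A‖ + 1) * ‖B - A‖ := by
  have h1 := Matrix.frobenius_norm_mul (B - A) Aᴴ
  have h2 := Matrix.frobenius_norm_mul A (B - A)ᴴ
  have h3 := Matrix.frobenius_norm_mul (B - A) (B - A)ᴴ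
  rw [Matrix.frobenius_norm_conjTranspose] at h1 h2 h3
  rw [gram_sub_eq]
  refine (norm_add₃_le).trans ?_
  nlinarith [norm_nonneg (B - A)]

theorem exists_gap (hA : IsFullSVD A U σ V) {π : Finset (Fin m)}
    (hne : ∀ i ∈ π, ∀ j ∉ π, σ i ≠ σ j) :
    ∃ g : ℝ, 0 < g ∧ ∀ a b, ¬(a ∈ π ↔ b ∈ π) → g ≤ |σ a ^ 2 - σ b ^ 2| := by
  set s : Finset (Fin m × Fin m) := Finset.univ.filter fun p => ¬(p.1 ∈ π ↔ p.2 ∈ π) with hs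
  have hpos : ∀ p ∈ s, 0 < |σ p.1 ^ 2 - σ p.2 ^ 2| := by
    rintro ⟨a, b⟩ hp
    have hp := (Finset.mem_filter.1 hp).2
    have hab : σ a ≠ σ b := by
      by_cases ha : a ∈ π
      · exact hne a ha b (fun hb => hp ⟨fun _ => hb, fun _ => ha⟩)
      · have hb : b ∈ π := by
          by_contra hb
          exact hp ⟨fun h => absurd h ha, fun h => absurd h hb⟩
        exact (hne b hb a ha).symm
    rw [abs_pos, sub_ne_zero]
    exact fun h => hab ((sq_eq_sq₀ (hA.nonneg a) (hA.nonneg b)).1 h)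
  rcases s.eq_empty_or_nonempty with h0 | h0
  · refine ⟨1, one_pos, fun a b hab => ?_⟩
    have : (a, b) ∈ s := Finset.mem_filter.2 ⟨Finset.mem_univ _, hab⟩
    simp [h0] at this
  · obtain ⟨p, hp, hmin⟩ := s.exists_min_image (fun p => |σ p.1 ^ 2 - σ p.2 ^ 2|) h0
    exact ⟨_, hpos p hp, fun a b hab => hmin (a, b) (Finset.mem_filter.2 ⟨Finset.mem_univ _, hab⟩)⟩

/-- The expansion of first order of the projector, uniform in `B` and in the choice of its singular
value decomposition. The singular values at the positions in `π` stay away from the others. -/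
theorem exists_expansion (hA : IsFullSVD A U σ V) {π : Finset (Fin m)}
    (hne : ∀ i ∈ π, ∀ j ∉ π, σ i ≠ σ j) :
    ∃ C δ : ℝ, 0 ≤ C ∧ 0 < δ ∧ ∀ (B : Matrix (Fin m) (Fin n) 𝕜) (U' : Matrix (Fin m) (Fin m) 𝕜)
      (σ' : Fin m → ℝ) (V' : Matrix (Fin n) (Fin n) 𝕜), IsFullSVD B U' σ' V' → ‖B - A‖ ≤ δ →
      (∀ i ∈ π, ∀ j ∉ π, σ' i ≠ σ' j) ∧
      ‖Uᴴ * (colProj π U' - colProj π U) * U -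
        firstOrder π σ (Uᴴ * ((B - A) * Aᴴ + A * (B - A)ᴴ) * U)‖ ≤ C * ‖B - A‖ ^ 2 := by
  obtain ⟨g, hg, hgap⟩ := exists_gap hA hne
  set c := 2 * ‖A‖ + 1 with hc
  have hc0 : 0 < c := by positivity
  set k := (g / 2)⁻¹ * c with hk
  refine ⟨m * m * (g⁻¹ * (1 + 2 * k * c) + k ^ 2), min 1 (g / (4 * c)), by positivity,
    by positivity, fun B U' σ' V' hB hBA => ?_⟩
  have hR : ‖B * Bᴴ - A * Aᴴ‖ ≤ c * ‖B - A‖ := norm_gram_sub_le A B (hBA.trans (min_le_left _ _))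
  have hR4 : ‖B * Bᴴ - A * Aᴴ‖ ≤ g / 4 := by
    refine hR.trans ?_
    have h1 := hBA.trans (min_le_right _ _)
    rw [le_div_iff₀ (by positivity)] at h1
    linarith
  have hweyl : ∀ a, |σ' a ^ 2 - σ a ^ 2| ≤ g / 4 := fun a => by
    have h1 := weyl_abs (𝕜 := 𝕜) hA.unitary_left hB.unitary_left hA.antitone_sq hB.antitone_sq a
    rw [← hA.mul_conjTranspose, ← hB.mul_conjTranspose] at h1
    exact h1.trans hR4
  refine ⟨fun i hi j hj hij => ?_, ?_⟩
  · have h1 := hgap i j (fun h => hj (h.1 hi))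
    have h2 := hweyl i
    have h3 := hweyl j
    rw [hij] at h2
    have h4 := abs_sub_le (σ i ^ 2) (σ' j ^ 2) (σ j ^ 2)
    rw [abs_sub_comm (σ i ^ 2) (σ' j ^ 2)] at h4
    linarith
  · have hP : ‖colProj π U' - colProj π U‖ ≤ k * ‖B - A‖ := by
      refine (norm_colProj_sub_le hA hB (half_pos hg) fun a b hab => ?_).trans ?_
      · have h1 := hgap a b hab
        have h3 := hweyl b
        have h4 := abs_sub_le (σ a ^ 2) (σ' b ^ 2) (σ b ^ 2)
        rw [abs_sub_comm (σ a ^ 2) (σ' b ^ 2)] at h4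
        linarith
      · rw [hk, mul_assoc]
        gcongr
    refine (norm_sub_firstOrder_le hA hB hg hgap).trans ?_
    calc _ ≤ m * m * (g⁻¹ * (‖B - A‖ ^ 2 + 2 * (k * ‖B - A‖) * (c * ‖B - A‖)) +
          (k * ‖B - A‖) ^ 2) := by gcongr
      _ = _ := by ring

/-- The projector does not depend on the choice of the singular value decomposition. -/
theorem colProj_unique (h : IsFullSVD A U σ V) (h' : IsFullSVD A U' σ' V') {π : Finset (Fin m)}
    (hne : ∀ i ∈ π, ∀ j ∉ π, σ i ≠ σ j) : colProj π U' = colProj π U := by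
  obtain ⟨g, hg, hgap⟩ := exists_gap h hne
  have hσ : ∀ k, σ' k ^ 2 = σ k ^ 2 := fun k => by
    have h1 := weyl_abs (𝕜 := 𝕜) h.unitary_left h'.unitary_left h.antitone_sq h'.antitone_sq k
    rw [← h.mul_conjTranspose, ← h'.mul_conjTranspose, sub_self, norm_zero, abs_nonpos_iff] at h1
    linarith
  have h1 := norm_colProj_sub_le (π := π) h h' hg fun a b hab => by
    rw [hσ, abs_sub_comm]
    exact hgap a b hab
  rw [sub_self, norm_zero, mul_zero, norm_le_zero_iff, sub_eq_zero] at h1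
  exact h1

theorem IsFullSVD.sigma_unique (h : IsFullSVD A U σ V) (h' : IsFullSVD A U' σ' V') : σ' = σ := by
  ext k
  have h1 := weyl_abs (𝕜 := 𝕜) h.unitary_left h'.unitary_left h.antitone_sq h'.antitone_sq k
  rw [← h.mul_conjTranspose, ← h'.mul_conjTranspose, sub_self, norm_zero, abs_nonpos_iff] at h1
  exact (sq_eq_sq₀ (h'.nonneg k) (h.nonneg k)).1 (sub_eq_zero.1 h1)

end

/-! ### Size of the first order change -/

theorem inverseGap_nonneg (x y : ℝ) : 0 ≤ inverseGap x y := by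
  unfold inverseGap
  positivity

theorem inverseGap_comm (x y : ℝ) : inverseGap x y = inverseGap y x := by
  unfold inverseGap
  rw [abs_sub_comm, add_comm (x ^ 2), add_comm x]

theorem inverseGap_sq (x y : ℝ) :
    inverseGap x y ^ 2 = (x ^ 2 + y ^ 2) / (x ^ 2 - y ^ 2) ^ 2 := by
  rw [inverseGap, mul_pow, Real.sq_sqrt (by positivity), div_pow, sq_abs, one_pow,
    div_mul_div_comm, one_mul]
  congr 1
  ring

theorem sum_ite_val_le (p k : ℕ) {x : ℝ} (hx : 0 ≤ x) :
    ∑ c : Fin p, (if c.val = k then x else 0) ≤ x := by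
  by_cases hk : k < p
  · rw [Finset.sum_eq_single (⟨k, hk⟩ : Fin p)]
    · simp
    · intro c _ hc
      rw [if_neg fun h => hc (Fin.ext h)]
    · simp
  · rw [Finset.sum_eq_zero]
    · exact hx
    · intro c _
      rw [if_neg]
      have := c.isLt
      omega

/-- The `n × m` matrix with ones on the diagonal; `M * padding 𝕜 m n` truncates `M` to its first `m`
columns or pads it with zero columns. -/
noncomputable def padding (𝕜 : Type*) [RCLike 𝕜] (m n : ℕ) : Matrix (Fin n) (Fin m) 𝕜 :=
  Matrix.of fun c b => if b.val = c.val then 1 else 0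

section

variable {m n : ℕ}

theorem mul_padding_apply {l : ℕ} (M : Matrix (Fin l) (Fin n) 𝕜) (a : Fin l) (b : Fin m) :
    (M * padding 𝕜 m n) a b = if h : b.val < n then M a ⟨b.val, h⟩ else 0 := by
  rw [Matrix.mul_apply]
  split_ifs with h
  · rw [Finset.sum_eq_single (⟨b.val, h⟩ : Fin n)]
    · simp [padding]
    · intro c _ hc
      have : b.val ≠ c.val := fun h => hc (Fin.ext h.symm)
      simp [padding, this]
    · simp
  · refine Finset.sum_eq_zero fun c _ => ?_
    have : b.val ≠ c.val := by
      have := c.isLt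
      omega
    simp [padding, this]

theorem norm_mul_padding_le {l : ℕ} (M : Matrix (Fin l) (Fin n) 𝕜) :
    ‖M * padding 𝕜 m n‖ ≤ ‖M‖ := by
  refine le_of_sq_le_sq ?_ (norm_nonneg _)
  rw [frobenius_sq, frobenius_sq]
  refine Finset.sum_le_sum fun a _ => ?_
  have h1 : ∀ b : Fin m, ‖(M * padding 𝕜 m n) a b‖ ^ 2 =
      ∑ c : Fin n, if b.val = c.val then ‖M a c‖ ^ 2 else 0 := fun b => by
    rw [mul_padding_apply]
    split_ifs with h
    · rw [Finset.sum_eq_single (⟨b.val, h⟩ : Fin n)]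
      · simp
      · intro c _ hc
        have : b.val ≠ c.val := fun h => hc (Fin.ext h.symm)
        simp [this]
      · simp
    · rw [Finset.sum_eq_zero]
      · simp
      · intro c _
        rw [if_neg]
        have := c.isLt
        omega
  simp only [h1]
  rw [Finset.sum_comm]
  exact Finset.sum_le_sum fun c _ => sum_ite_val_le m c.val (by positivity)

theorem conjTranspose_rectDiag (σ : Fin m → ℝ) :
    (rectDiag 𝕜 n σ)ᴴ = padding 𝕜 m n * Matrix.diagonal (fun k => (σ k : 𝕜)) := by
  ext c b
  rw [Matrix.mul_diagonal]
  by_cases h : b.val = c.val <;> simp [rectDiag, padding, h]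

variable {A : Matrix (Fin m) (Fin n) 𝕜} {U : Matrix (Fin m) (Fin m) 𝕜} {σ : Fin m → ℝ}
  {V : Matrix (Fin n) (Fin n) 𝕜}

/-- The derivative of `A * Aᴴ` in the direction `E`, in the basis `U`, in terms of the matrix of `E`
in the bases `U` and `V`, brought to the size `m × m`. -/
theorem IsFullSVD.gram_deriv_eq (h : IsFullSVD A U σ V) (E : Matrix (Fin m) (Fin n) 𝕜) :
    Uᴴ * (E * Aᴴ + A * Eᴴ) * U =
      Uᴴ * E * V * padding 𝕜 m n * Matrix.diagonal (fun k => (σ k : 𝕜)) +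
      (Uᴴ * E * V * padding 𝕜 m n * Matrix.diagonal (fun k => (σ k : 𝕜)))ᴴ := by
  have h1 : Uᴴ * E * V * padding 𝕜 m n * Matrix.diagonal (fun k => (σ k : 𝕜)) =
      Uᴴ * (E * Aᴴ) * U := by
    rw [Matrix.mul_assoc, ← conjTranspose_rectDiag, Matrix.mul_assoc, ← h.conjTranspose_mul_eq]
    simp only [Matrix.mul_assoc]
  rw [h1, Matrix.mul_add, Matrix.add_mul]
  congr 1
  simp only [Matrix.conjTranspose_mul, Matrix.conjTranspose_conjTranspose, Matrix.mul_assoc]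

theorem add_conjTranspose_diagonal_apply (L : Matrix (Fin m) (Fin m) 𝕜) (σ : Fin m → ℝ)
    (a b : Fin m) :
    (L * Matrix.diagonal (fun k => (σ k : 𝕜)) +
      (L * Matrix.diagonal (fun k => (σ k : 𝕜)))ᴴ) a b = L a b * σ b + star (L b a) * σ a := by
  rw [Matrix.add_apply, Matrix.conjTranspose_apply, Matrix.mul_diagonal, Matrix.mul_diagonal,
    star_mul', RCLike.star_def, RCLike.conj_ofReal]

/-- By Cauchy-Schwarz, `(|L a b| σ b + |L b a| σ a) ^ 2 ≤ (σ a ^ 2 + σ b ^ 2) (|L a b| ^ 2 +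
|L b a| ^ 2)`; each entry of `L` is used twice in the sum over all positions. -/
theorem sq_norm_firstOrder_le {π : Finset (Fin m)} {κ : ℝ}
    (hκ : ∀ a b, ¬(a ∈ π ↔ b ∈ π) → inverseGap (σ a) (σ b) ≤ κ) (L : Matrix (Fin m) (Fin m) 𝕜) :
    ‖firstOrder π σ (L * Matrix.diagonal (fun k => (σ k : 𝕜)) +
      (L * Matrix.diagonal (fun k => (σ k : 𝕜)))ᴴ)‖ ^ 2 ≤ 2 * κ ^ 2 * ‖L‖ ^ 2 := by
  have hentry : ∀ a b, ‖firstOrder π σ (L * Matrix.diagonal (fun k => (σ k : 𝕜)) +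
      (L * Matrix.diagonal (fun k => (σ k : 𝕜)))ᴴ) a b‖ ^ 2 ≤
        κ ^ 2 * (‖L a b‖ ^ 2 + ‖L b a‖ ^ 2) := fun a b => by
    rw [firstOrder, Matrix.of_apply, add_conjTranspose_diagonal_apply]
    split_ifs with hab
    · rw [norm_zero, zero_pow two_ne_zero]
      positivity
    all_goals
      have h1 : ‖L a b * σ b + star (L b a) * σ a‖ ≤ ‖L a b‖ * |σ b| + ‖L b a‖ * |σ a| := by
        refine (norm_add_le _ _).trans (le_of_eq ?_)
        rw [norm_mul, norm_mul, norm_star, RCLike.norm_ofReal, RCLike.norm_ofReal]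
      have h2 : ‖L a b * σ b + star (L b a) * σ a‖ ^ 2 ≤
          (σ a ^ 2 + σ b ^ 2) * (‖L a b‖ ^ 2 + ‖L b a‖ ^ 2) := by
        refine (pow_le_pow_left₀ (norm_nonneg _) h1 2).trans ?_
        rw [← sq_abs (σ a), ← sq_abs (σ b)]
        nlinarith [sq_nonneg (‖L a b‖ * |σ a| - ‖L b a‖ * |σ b|)]
      have h3 : inverseGap (σ a) (σ b) ^ 2 ≤ κ ^ 2 :=
        pow_le_pow_left₀ (inverseGap_nonneg _ _) (hκ a b hab) 2
      simp only [one_mul, neg_one_mul, neg_div, norm_neg, norm_div]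
      rw [div_pow, RCLike.norm_ofReal, sq_abs]
      calc _ ≤ (σ a ^ 2 + σ b ^ 2) * (‖L a b‖ ^ 2 + ‖L b a‖ ^ 2) / (σ a ^ 2 - σ b ^ 2) ^ 2 := by
            gcongr
        _ = inverseGap (σ a) (σ b) ^ 2 * (‖L a b‖ ^ 2 + ‖L b a‖ ^ 2) := by
            rw [inverseGap_sq]
            ring
        _ ≤ _ := by gcongr
  rw [frobenius_sq]
  refine (Finset.sum_le_sum fun a _ => Finset.sum_le_sum fun b _ => hentry a b).trans
    (le_of_eq ?_)
  have h4 : ∑ a, ∑ b, ‖L b a‖ ^ 2 = ‖L‖ ^ 2 := by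
    rw [frobenius_sq, Finset.sum_comm]
  simp only [← Finset.mul_sum, Finset.sum_add_distrib]
  rw [h4, ← frobenius_sq]
  ring

theorem IsFullSVD.sq_norm_firstOrder_le (h : IsFullSVD A U σ V) {π : Finset (Fin m)} {κ : ℝ}
    (hκ : ∀ a b, ¬(a ∈ π ↔ b ∈ π) → inverseGap (σ a) (σ b) ≤ κ) (E : Matrix (Fin m) (Fin n) 𝕜) :
    ‖firstOrder π σ (Uᴴ * (E * Aᴴ + A * Eᴴ) * U)‖ ^ 2 ≤ 2 * κ ^ 2 * ‖E‖ ^ 2 := by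
  rw [h.gram_deriv_eq]
  refine (SingularSubspace.sq_norm_firstOrder_le hκ _).trans ?_
  have h1 : ‖Uᴴ * E * V * padding 𝕜 m n‖ ≤ ‖E‖ := by
    refine (norm_mul_padding_le _).trans (le_of_eq ?_)
    rw [frobenius_mul_coisometry (mul_conjTranspose_self_of_unitary h.unitary_right),
      frobenius_isometry_mul]
    rw [Matrix.conjTranspose_conjTranspose, mul_conjTranspose_self_of_unitary h.unitary_left]
  gcongr

/-! ### The worst direction -/

/-- The matrix with the entry `σ_i (σ_i² - σ_j²) / (σ_i² + σ_j²)` at `(j, i)` and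
`σ_j (σ_i² - σ_j²) / (σ_i² + σ_j²)` at `(i, j)`: the worst direction in the bases of the singular
vectors. A position outside of the matrix has the entry `0`. -/
noncomputable def worstCore (𝕜 : Type*) [RCLike 𝕜] {m : ℕ} (n : ℕ) (σ : Fin m → ℝ) (i j : Fin m) :
    Matrix (Fin m) (Fin n) 𝕜 :=
  Matrix.of fun a c =>
    if a = j ∧ c.val = i.val then
      ((σ i * (σ i ^ 2 - σ j ^ 2) / (σ i ^ 2 + σ j ^ 2) : ℝ) : 𝕜)
    else if a = i ∧ c.val = j.val then
      ((σ j * (σ i ^ 2 - σ j ^ 2) / (σ i ^ 2 + σ j ^ 2) : ℝ) : 𝕜)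
    else 0

theorem unitMat_mul_apply {p q : ℕ} (k l : Fin p) (M : Matrix (Fin p) (Fin q) 𝕜) (a : Fin p)
    (c : Fin q) : (unitMat 𝕜 p k l * M) a c = if a = k then M l c else 0 := by
  rw [Matrix.mul_apply, Finset.sum_eq_single l]
  · simp [unitMat, Fin.ext_iff]
  · intro b _ hb
    simp [unitMat, Fin.val_inj, hb]
  · simp

theorem mul_unitMat_apply {p q : ℕ} (k l : Fin q) (M : Matrix (Fin p) (Fin q) 𝕜) (a : Fin p)
    (c : Fin q) : (M * unitMat 𝕜 q k l) a c = if c = l then M a k else 0 := by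
  rw [Matrix.mul_apply, Finset.sum_eq_single k]
  · simp [unitMat, Fin.ext_iff]
  · intro b _ hb
    simp [unitMat, Fin.val_inj, hb]
  · simp

theorem IsFullSVD.worstDirection_eq (h : IsFullSVD A U σ V) {i j : Fin m} (hij : σ i ≠ σ j) :
    worstDirection A.rank U σ V i j = U * worstCore 𝕜 n σ i j * Vᴴ := by
  have hne : i ≠ j := fun h => hij (h ▸ rfl)
  have hnev : i.val ≠ j.val := fun h => hne (Fin.ext h)
  have h1 : worstDirection A.rank U σ V i j =
      U * ((unitMat 𝕜 m j i - unitMat 𝕜 m i j) * rectDiag 𝕜 n σ +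
        if i.val < A.rank ∧ j.val < A.rank then (2 * (σ i * σ j / (σ i ^ 2 + σ j ^ 2))) •
          (rectDiag 𝕜 n σ * (unitMat 𝕜 n i j - unitMat 𝕜 n j i)) else 0) * Vᴴ := by
    rw [worstDirection, Matrix.mul_add, Matrix.add_mul]
    congr 1
    · simp only [Matrix.mul_assoc]
    · split_ifs
      · rw [Matrix.mul_smul, Matrix.smul_mul]
        simp only [Matrix.mul_assoc]
      · simp
  rw [h1]
  congr 2
  ext a c
  have hE : ((unitMat 𝕜 m j i - unitMat 𝕜 m i j) * rectDiag 𝕜 n σ) a c =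
      (if a = j ∧ c.val = i.val then (σ i : 𝕜) else 0) -
        (if a = i ∧ c.val = j.val then (σ j : 𝕜) else 0) := by
    rw [Matrix.sub_mul, Matrix.sub_apply, unitMat_mul_apply, unitMat_mul_apply]
    simp only [rectDiag, Matrix.of_apply, ite_and, eq_comm]
  rw [Matrix.add_apply, hE, worstCore, Matrix.of_apply]
  have hD : σ i ^ 2 + σ j ^ 2 ≠ 0 := fun h0 => hij <| by
    have h2 : σ i ^ 2 = 0 := by nlinarith [sq_nonneg (σ i), sq_nonneg (σ j)]
    have h3 : σ j ^ 2 = 0 := by nlinarith [sq_nonneg (σ i), sq_nonneg (σ j)]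
    rw [pow_eq_zero_iff two_ne_zero] at h2 h3
    rw [h2, h3]
  have hexcl : a = j ∧ c.val = i.val → ¬(a = i ∧ c.val = j.val) := fun h h' =>
    hne (h'.1.symm.trans h.1)
  by_cases hr : i.val < A.rank ∧ j.val < A.rank
  · have hin : i.val < n := hr.1.trans_le (Matrix.rank_le_width A)
    have hjn : j.val < n := hr.2.trans_le (Matrix.rank_le_width A)
    have hF : (rectDiag 𝕜 n σ * (unitMat 𝕜 n i j - unitMat 𝕜 n j i)) a c =
        (if a = i ∧ c.val = j.val then (σ i : 𝕜) else 0) -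
          (if a = j ∧ c.val = i.val then (σ j : 𝕜) else 0) := by
      have e1 := mul_unitMat_apply ⟨i.val, hin⟩ ⟨j.val, hjn⟩ (rectDiag 𝕜 n σ) a c
      have e2 := mul_unitMat_apply ⟨j.val, hjn⟩ ⟨i.val, hin⟩ (rectDiag 𝕜 n σ) a c
      rw [Matrix.mul_sub, Matrix.sub_apply, e1, e2]
      simp only [rectDiag, Matrix.of_apply, Fin.ext_iff, ite_and]
      congr 1
      · by_cases hc : c.val = j.val <;> by_cases ha : a.val = i.val
        · simp [hc, Fin.ext ha]
        all_goals simp [hc, ha]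
      · by_cases hc : c.val = i.val <;> by_cases ha : a.val = j.val
        · simp [hc, Fin.ext ha]
        all_goals simp [hc, ha]
    rw [if_pos hr, Matrix.smul_apply, hF, RCLike.real_smul_eq_coe_mul]
    by_cases hc1 : a = j ∧ c.val = i.val
    · rw [if_pos hc1, if_neg (hexcl hc1), if_neg (hexcl hc1), if_pos hc1, if_pos hc1]
      norm_cast
      field_simp
      ring
    · rw [if_neg hc1, if_neg hc1, if_neg hc1]
      by_cases hc2 : a = i ∧ c.val = j.val
      · rw [if_pos hc2, if_pos hc2, if_pos hc2]
        norm_cast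
        field_simp
        ring
      · rw [if_neg hc2, if_neg hc2, if_neg hc2]
        simp
  · rw [if_neg hr, Matrix.zero_apply, add_zero]
    have hzero : σ i = 0 ∨ σ j = 0 := by
      by_contra hcon
      push Not at hcon
      refine hr ⟨?_, ?_⟩
      · by_contra hlt
        exact hcon.1 (h.zero i (not_lt.1 hlt))
      · by_contra hlt
        exact hcon.2 (h.zero j (not_lt.1 hlt))
    by_cases hc1 : a = j ∧ c.val = i.val
    · rw [if_pos hc1, if_neg (hexcl hc1), if_pos hc1, sub_zero, RCLike.ofReal_inj, eq_div_iff hD]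
      rcases hzero with h0 | h0 <;> rw [h0] <;> ring
    · rw [if_neg hc1, if_neg hc1]
      by_cases hc2 : a = i ∧ c.val = j.val
      · rw [if_pos hc2, if_pos hc2, zero_sub, ← RCLike.ofReal_neg, RCLike.ofReal_inj,
          eq_div_iff hD]
        rcases hzero with h0 | h0 <;> rw [h0] <;> ring
      · rw [if_neg hc2, if_neg hc2, sub_zero]

theorem sq_norm_worstCore_le (σ : Fin m → ℝ) (i j : Fin m) :
    ‖worstCore 𝕜 n σ i j‖ ^ 2 ≤ (σ i ^ 2 - σ j ^ 2) ^ 2 / (σ i ^ 2 + σ j ^ 2) := by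
  set x := σ i * (σ i ^ 2 - σ j ^ 2) / (σ i ^ 2 + σ j ^ 2) with hx
  set y := σ j * (σ i ^ 2 - σ j ^ 2) / (σ i ^ 2 + σ j ^ 2) with hy
  have h1 : ∀ a c, ‖worstCore 𝕜 n σ i j a c‖ ^ 2 ≤
      (if a = j then (if c.val = i.val then x ^ 2 else 0) else 0) +
        (if a = i then (if c.val = j.val then y ^ 2 else 0) else 0) := fun a c => by
    rw [worstCore, Matrix.of_apply, ← hx, ← hy]
    simp only [← ite_and]
    split_ifs <;> simp [sq_nonneg]
  have h2 : ∀ (k : Fin m) (l : ℕ) (z : ℝ),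
      ∑ a, ∑ c : Fin n, (if a = k then (if c.val = l then z ^ 2 else 0) else 0) ≤ z ^ 2 :=
    fun k l z => by
      rw [Finset.sum_eq_single k]
      · simpa using sum_ite_val_le n l (sq_nonneg z)
      · intro a _ ha
        simp [ha]
      · simp
  rw [frobenius_sq]
  refine (Finset.sum_le_sum fun a _ => Finset.sum_le_sum fun c _ => h1 a c).trans ?_
  simp only [Finset.sum_add_distrib]
  refine (add_le_add (h2 j i.val x) (h2 i j.val y)).trans (le_of_eq ?_)
  rw [hx, hy]
  by_cases h0 : σ i ^ 2 + σ j ^ 2 = 0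
  · rw [h0]
    simp
  · field_simp

/-- Equality holds; only this inequality is needed, the other one being a case of
`IsFullSVD.sq_norm_firstOrder_le`. -/
theorem IsFullSVD.inverseGap_mul_norm_worstDirection_le (h : IsFullSVD A U σ V) {i j : Fin m}
    (hij : σ i ≠ σ j) : inverseGap (σ i) (σ j) * ‖worstDirection A.rank U σ V i j‖ ≤ 1 := by
  have hV : Vᴴ * (Vᴴ)ᴴ = 1 := by
    rw [Matrix.conjTranspose_conjTranspose, conjTranspose_mul_self_of_unitary h.unitary_right]
  rw [h.worstDirection_eq hij, frobenius_mul_coisometry hV,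
    frobenius_isometry_mul (conjTranspose_mul_self_of_unitary h.unitary_left)]
  refine le_of_sq_le_sq ?_ zero_le_one
  have h1 : σ i ^ 2 - σ j ^ 2 ≠ 0 := fun h0 =>
    hij ((sq_eq_sq₀ (h.nonneg i) (h.nonneg j)).1 (sub_eq_zero.1 h0))
  have h2 : σ i ^ 2 + σ j ^ 2 ≠ 0 := fun h0 => h1 (by
    nlinarith [sq_nonneg (σ i), sq_nonneg (σ j)])
  rw [mul_pow, inverseGap_sq]
  calc _ ≤ (σ i ^ 2 + σ j ^ 2) / (σ i ^ 2 - σ j ^ 2) ^ 2 *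
        ((σ i ^ 2 - σ j ^ 2) ^ 2 / (σ i ^ 2 + σ j ^ 2)) := by
        gcongr
        exact sq_norm_worstCore_le σ i j
    _ = 1 ^ 2 := by field_simp

/-- In the worst direction the entries at `(i, j)` and `(j, i)` of the first order change of the
projector are `1`. -/
theorem IsFullSVD.le_norm_firstOrder_worstDirection (h : IsFullSVD A U σ V) {π : Finset (Fin m)}
    {i j : Fin m} (hi : i ∈ π) (hj : j ∉ π) (hij : σ i ≠ σ j) (t : ℝ) :
    2 * t ^ 2 ≤ ‖firstOrder π σ (Uᴴ * ((t • worstDirection A.rank U σ V i j) * Aᴴ +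
      A * (t • worstDirection A.rank U σ V i j)ᴴ) * U)‖ ^ 2 := by
  have hne : i ≠ j := fun h => hij (h ▸ rfl)
  have h1 : σ i ^ 2 - σ j ^ 2 ≠ 0 := fun h0 =>
    hij ((sq_eq_sq₀ (h.nonneg i) (h.nonneg j)).1 (sub_eq_zero.1 h0))
  have h1' : σ j ^ 2 - σ i ^ 2 ≠ 0 := fun h0 => h1 (by linarith)
  have h2 : σ i ^ 2 + σ j ^ 2 ≠ 0 := fun h0 => h1 (by
    nlinarith [sq_nonneg (σ i), sq_nonneg (σ j)])
  set x := σ i * (σ i ^ 2 - σ j ^ 2) / (σ i ^ 2 + σ j ^ 2) with hx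
  set y := σ j * (σ i ^ 2 - σ j ^ 2) / (σ i ^ 2 + σ j ^ 2) with hy
  rw [h.gram_deriv_eq]
  set L := Uᴴ * (t • worstDirection A.rank U σ V i j) * V * padding 𝕜 m n with hL
  have hL' : L = t • (worstCore 𝕜 n σ i j * padding 𝕜 m n) := by
    have e : Uᴴ * (U * worstCore 𝕜 n σ i j * Vᴴ) * V =
        (Uᴴ * U) * worstCore 𝕜 n σ i j * (Vᴴ * V) := by
      simp only [Matrix.mul_assoc]
    rw [hL, h.worstDirection_eq hij, Matrix.mul_smul, Matrix.smul_mul, Matrix.smul_mul, e,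
      conjTranspose_mul_self_of_unitary h.unitary_left,
      conjTranspose_mul_self_of_unitary h.unitary_right, Matrix.one_mul, Matrix.mul_one]
  have hLji : L j i = ((t * x : ℝ) : 𝕜) := by
    rw [hL', Matrix.smul_apply, mul_padding_apply, RCLike.real_smul_eq_coe_mul, RCLike.ofReal_mul]
    congr 1
    split_ifs with hin
    · simp [worstCore, ← hx]
    · rw [hx, h.eq_zero_of_le i (not_lt.1 hin)]
      simp
  have hLij : L i j = ((t * y : ℝ) : 𝕜) := by
    rw [hL', Matrix.smul_apply, mul_padding_apply, RCLike.real_smul_eq_coe_mul, RCLike.ofReal_mul]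
    congr 1
    split_ifs with hin
    · simp [worstCore, ← hy, hne]
    · rw [hy, h.eq_zero_of_le j (not_lt.1 hin)]
      simp
  have hxy : x * σ i + y * σ j = σ i ^ 2 - σ j ^ 2 := by
    rw [hx, hy]
    field_simp
  have e1 : firstOrder π σ (L * Matrix.diagonal (fun k => (σ k : 𝕜)) +
      (L * Matrix.diagonal (fun k => (σ k : 𝕜)))ᴴ) i j = (t : 𝕜) := by
    rw [firstOrder, Matrix.of_apply, add_conjTranspose_diagonal_apply, hLji, hLij, RCLike.star_def,
      RCLike.conj_ofReal, if_neg (fun h => hj (h.1 hi)), if_pos hi, one_mul]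
    norm_cast
    rw [div_eq_iff h1, ← hxy]
    ring
  have e2 : firstOrder π σ (L * Matrix.diagonal (fun k => (σ k : 𝕜)) +
      (L * Matrix.diagonal (fun k => (σ k : 𝕜)))ᴴ) j i = (t : 𝕜) := by
    rw [firstOrder, Matrix.of_apply, add_conjTranspose_diagonal_apply, hLji, hLij, RCLike.star_def,
      RCLike.conj_ofReal, if_neg (fun h => hj (h.2 hi)), if_neg hj, neg_one_mul]
    norm_cast
    rw [div_eq_iff h1', ← neg_sub (σ i ^ 2), ← hxy]
    ring
  set F := firstOrder π σ (L * Matrix.diagonal (fun k => (σ k : 𝕜)) +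
      (L * Matrix.diagonal (fun k => (σ k : 𝕜)))ᴴ)
  have h3 : ∑ a ∈ {i, j}, ∑ b, ‖F a b‖ ^ 2 ≤ ‖F‖ ^ 2 := by
    rw [frobenius_sq]
    exact Finset.sum_le_sum_of_subset_of_nonneg (Finset.subset_univ _)
      (fun _ _ _ => by positivity)
  rw [Finset.sum_pair hne] at h3
  have h4 : ‖F i j‖ ^ 2 ≤ ∑ b, ‖F i b‖ ^ 2 :=
    Finset.single_le_sum (f := fun b => ‖F i b‖ ^ 2) (fun _ _ => by positivity) (Finset.mem_univ j)
  have h5 : ‖F j i‖ ^ 2 ≤ ∑ b, ‖F j b‖ ^ 2 :=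
    Finset.single_le_sum (f := fun b => ‖F j b‖ ^ 2) (fun _ _ => by positivity) (Finset.mem_univ i)
  rw [e1, RCLike.norm_ofReal, sq_abs] at h4
  rw [e2, RCLike.norm_ofReal, sq_abs] at h5
  linarith

end

/-! ### Principal angles and the three distances -/

theorem sum_singVal_sq {d : ℕ} (M : Matrix (Fin d) (Fin d) 𝕜) :
    ∑ k : Fin d, singVal M k ^ 2 = ‖M‖ ^ 2 := by
  set T := Matrix.toEuclideanLin M with hT
  have h1 := T.isSymmetric_adjoint_comp_self.re_trace_eq_sum_eigenvalues finrank_euclideanSpace_fin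
  have h2 : ∀ k : Fin d, singVal M k ^ 2 =
      T.isSymmetric_adjoint_comp_self.eigenvalues finrank_euclideanSpace_fin k := fun k =>
    T.sq_singularValues_fin finrank_euclideanSpace_fin k
  rw [Finset.sum_congr rfl fun k _ => h2 k, ← h1, hT, toLin_adjoint_comp_self,
    frobenius_sq_eq_trace, Matrix.toEuclideanLin_eq_toLin_orthonormal, Matrix.trace_toLin_eq]

theorem norm_conjTranspose_mul_col_le {p d : ℕ} {Q : Matrix (Fin p) (Fin d) 𝕜} (hQ : Qᴴ * Q = 1)
    (Z : Matrix (Fin p) (Fin 1) 𝕜) : ‖Qᴴ * Z‖ ≤ ‖Z‖ := by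
  have h1 : ‖Qᴴ * Z‖ ^ 2 ≤ ‖Z‖ * ‖Qᴴ * Z‖ := by
    have e : (Qᴴ * Z)ᴴ * (Qᴴ * Z) = Zᴴ * (Q * (Qᴴ * Z)) := by
      rw [Matrix.conjTranspose_mul, Matrix.conjTranspose_conjTranspose, Matrix.mul_assoc]
    rw [frobenius_sq_eq_trace, e, Matrix.trace_fin_one]
    calc _ ≤ ‖(Zᴴ * (Q * (Qᴴ * Z))) 0 0‖ := RCLike.re_le_norm _
      _ ≤ ‖Zᴴ * (Q * (Qᴴ * Z))‖ := norm_entry_le _ _ _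
      _ ≤ ‖Zᴴ‖ * ‖Q * (Qᴴ * Z)‖ := Matrix.frobenius_norm_mul _ _
      _ = _ := by rw [Matrix.frobenius_norm_conjTranspose, frobenius_isometry_mul hQ]
  nlinarith [norm_nonneg (Qᴴ * Z), norm_nonneg Z]

/-- The cosines `singVal (Qᴴ * Q') k` of the principal angles lie in the range where `Real.arccos`
is not truncated. -/
theorem singVal_le_one {p d : ℕ} {Q Q' : Matrix (Fin p) (Fin d) 𝕜} (hQ : Qᴴ * Q = 1)
    (hQ' : Q'ᴴ * Q' = 1) (k : Fin d) : singVal (Qᴴ * Q') k ≤ 1 := by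
  set M := Qᴴ * Q' with hM
  have h1 := (Matrix.toEuclideanLin M).hasEigenvalue_adjoint_comp_self_sq_singularValues
    (n := k) (by simp)
  obtain ⟨v, hv⟩ := h1.exists_hasEigenvector
  have hv1 := hv.apply_eq_smul
  rw [toLin_adjoint_comp_self] at hv1
  set Y : Matrix (Fin d) (Fin 1) 𝕜 := Matrix.of fun a _ => v a with hY
  have hYpos : 0 < ‖Y‖ := by
    rw [norm_pos_iff]
    intro h
    refine hv.2 ?_
    ext a
    simpa [hY] using congrFun (congrFun h a) 0
  have hMY : Mᴴ * M * Y = ((singVal M k ^ 2 : ℝ) : 𝕜) • Y := by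
    ext a b
    have h2 := congrArg (fun x : EuclideanSpace 𝕜 (Fin d) => x a) hv1
    rw [Matrix.toLpLin_apply] at h2
    rw [Matrix.mul_apply]
    simpa [hY, Matrix.mulVec, dotProduct, singVal] using h2
  have h3 : ‖M * Y‖ ^ 2 = singVal M k ^ 2 * ‖Y‖ ^ 2 := by
    rw [frobenius_sq_eq_trace, frobenius_sq_eq_trace, Matrix.conjTranspose_mul, Matrix.mul_assoc,
      ← Matrix.mul_assoc Mᴴ, hMY, Matrix.mul_smul, Matrix.trace_smul, smul_eq_mul,
      RCLike.re_ofReal_mul]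
  have h4 : ‖M * Y‖ ≤ ‖Y‖ := by
    rw [hM, Matrix.mul_assoc]
    refine (norm_conjTranspose_mul_col_le hQ _).trans (le_of_eq ?_)
    exact frobenius_isometry_mul hQ' Y
  have h5 : (singVal M k * ‖Y‖) ^ 2 ≤ ‖Y‖ ^ 2 := by
    rw [mul_pow, ← h3]
    exact pow_le_pow_left₀ (norm_nonneg _) h4 2
  have h6 := le_of_sq_le_sq h5 (norm_nonneg _)
  exact (mul_le_iff_le_one_left hYpos).1 h6

section

variable {d p : ℕ}

theorem frame_orthonormal (P : Grassmannian 𝕜 d p) : (frame P)ᴴ * frame P = 1 :=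
  P.2.choose_spec.1

theorem frame_mul_conjTranspose (P : Grassmannian 𝕜 d p) :
    frame P * (frame P)ᴴ = (P : Matrix (Fin p) (Fin p) 𝕜) :=
  P.2.choose_spec.2.symm

theorem principalAngle_nonneg (P P' : Grassmannian 𝕜 d p) (k : Fin d) : 0 ≤ principalAngle P P' k :=
  Real.arccos_nonneg _

theorem principalAngle_le (P P' : Grassmannian 𝕜 d p) (k : Fin d) :
    principalAngle P P' k ≤ Real.pi / 2 :=
  Real.arccos_le_pi_div_two.2 (singVal_nonneg _ _)

theorem sin_principalAngle_sq (P P' : Grassmannian 𝕜 d p) (k : Fin d) :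
    Real.sin (principalAngle P P' k) ^ 2 = 1 - singVal ((frame P)ᴴ * frame P') k ^ 2 := by
  have h0 := singVal_nonneg ((frame P)ᴴ * frame P') k
  have h1 := singVal_le_one (frame_orthonormal P) (frame_orthonormal P') k
  rw [principalAngle, Real.sin_arccos, Real.sq_sqrt]
  nlinarith

/-- The chordal distance is the Frobenius distance of the projectors, divided by `√2`. -/
theorem sum_sin_principalAngle_sq (P P' : Grassmannian 𝕜 d p) :
    ∑ k, Real.sin (principalAngle P P' k) ^ 2 =
      ‖(P' : Matrix (Fin p) (Fin p) 𝕜) - P‖ ^ 2 / 2 := by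
  simp only [sin_principalAngle_sq]
  rw [Finset.sum_sub_distrib, sum_singVal_sq, ← frame_mul_conjTranspose P,
    ← frame_mul_conjTranspose P']
  have hQ := frame_orthonormal P
  have hQ' := frame_orthonormal P'
  set Q := frame P
  set Q' := frame P'
  have e : (Q' * Q'ᴴ - Q * Qᴴ)ᴴ * (Q' * Q'ᴴ - Q * Qᴴ) =
      Q' * (Q'ᴴ * Q') * Q'ᴴ - Q' * (Q'ᴴ * Q * Qᴴ) - (Q * (Qᴴ * Q' * Q'ᴴ) - Q * (Qᴴ * Q) * Qᴴ) := by
    simp only [Matrix.conjTranspose_sub, Matrix.conjTranspose_mul,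
      Matrix.conjTranspose_conjTranspose, Matrix.sub_mul, Matrix.mul_sub, Matrix.mul_assoc]
    abel
  have t1 : (Q' * (Q'ᴴ * Q * Qᴴ)).trace = ((Qᴴ * Q')ᴴ * (Qᴴ * Q')).trace := by
    rw [Matrix.trace_mul_comm, Matrix.conjTranspose_mul, Matrix.conjTranspose_conjTranspose,
      Matrix.mul_assoc]
  have t2 : (Q * (Qᴴ * Q' * Q'ᴴ)).trace = ((Qᴴ * Q')ᴴ * (Qᴴ * Q')).trace := by
    rw [Matrix.trace_mul_comm, Matrix.mul_assoc, Matrix.trace_mul_comm, Matrix.conjTranspose_mul,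
      Matrix.conjTranspose_conjTranspose]
  rw [frobenius_sq_eq_trace (Q' * Q'ᴴ - Q * Qᴴ), e, hQ, hQ', Matrix.mul_one, Matrix.mul_one,
    Matrix.trace_sub, Matrix.trace_sub, Matrix.trace_sub, t1, t2, Matrix.trace_mul_comm Q',
    Matrix.trace_mul_comm Q, hQ, hQ']
  simp only [map_sub, ← frobenius_sq_eq_trace, Matrix.trace_one, Fintype.card_fin,
    RCLike.natCast_re]
  simp only [Finset.sum_const, Finset.card_univ, Fintype.card_fin, nsmul_eq_mul, mul_one]
  ring

/-- The function of the principal angles whose Euclidean norm is the distance. -/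
noncomputable def GrMetric.angleFun (s : GrMetric) (θ : ℝ) : ℝ :=
  match s with
  | .chordal => Real.sin θ
  | .grassmann => θ
  | .procrustes => 2 * Real.sin (θ / 2)

theorem GrMetric.dist_eq (s : GrMetric) (P P' : Grassmannian 𝕜 d p) :
    s.dist P P' = √(∑ k, s.angleFun (principalAngle P P' k) ^ 2) := by
  cases s <;> rfl

theorem GrMetric.sin_le_angleFun (s : GrMetric) {θ : ℝ} (h0 : 0 ≤ θ) (h1 : θ ≤ Real.pi / 2) :
    Real.sin θ ≤ s.angleFun θ ∧ s.angleFun θ ≤ θ := by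
  have hpi := Real.pi_pos
  cases s
  · exact ⟨le_rfl, Real.sin_le h0⟩
  · exact ⟨Real.sin_le h0, le_rfl⟩
  · have h2 : Real.sin θ = 2 * Real.sin (θ / 2) * Real.cos (θ / 2) := by
      rw [← Real.sin_two_mul]
      ring_nf
    have h3 : 0 ≤ Real.sin (θ / 2) := Real.sin_nonneg_of_nonneg_of_le_pi (by linarith)
      (by linarith)
    have h4 := Real.cos_le_one (θ / 2)
    have h5 := Real.sin_le (x := θ / 2) (by linarith)
    refine ⟨?_, ?_⟩
    · rw [h2]
      exact mul_le_of_le_one_right (by positivity) h4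
    · change 2 * Real.sin (θ / 2) ≤ θ
      linarith

theorem mul_cos_le_sin {θ : ℝ} (h0 : 0 ≤ θ) (h1 : θ ≤ Real.pi / 2) :
    θ * Real.cos θ ≤ Real.sin θ := by
  rcases h1.lt_or_eq with h | h
  · have hc : 0 < Real.cos θ := Real.cos_pos_of_mem_Ioo ⟨by linarith [Real.pi_pos], h⟩
    have := Real.le_tan h0 h
    rwa [Real.tan_eq_sin_div_cos, le_div_iff₀ hc] at this
  · rw [h]
    simp

/-- Each of the distances is at least the chordal one. -/
theorem GrMetric.le_dist (s : GrMetric) (P P' : Grassmannian 𝕜 d p) :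
    ‖(P' : Matrix (Fin p) (Fin p) 𝕜) - P‖ / √2 ≤ s.dist P P' := by
  rw [s.dist_eq]
  refine Real.le_sqrt_of_sq_le ?_
  rw [div_pow, Real.sq_sqrt zero_le_two, ← sum_sin_principalAngle_sq]
  gcongr with k
  · exact Real.sin_nonneg_of_nonneg_of_le_pi (principalAngle_nonneg _ _ _)
      ((principalAngle_le _ _ _).trans (by linarith [Real.pi_pos]))
  · exact (s.sin_le_angleFun (principalAngle_nonneg _ _ _) (principalAngle_le _ _ _)).1

/-- Each of the distances is at most the chordal one, up to a factor that is close to `1` when the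
latter is small: `θ ^ 2 * (1 - u ^ 2) ≤ θ ^ 2 * cos θ ^ 2 ≤ sin θ ^ 2` if `sin θ ≤ u`. -/
theorem GrMetric.dist_le (s : GrMetric) (P P' : Grassmannian 𝕜 d p) {u : ℝ} (hu0 : 0 ≤ u)
    (hu1 : u < 1) (hu : ‖(P' : Matrix (Fin p) (Fin p) 𝕜) - P‖ / √2 ≤ u) :
    s.dist P P' ≤ u / √(1 - u ^ 2) := by
  have hu2 : 0 < 1 - u ^ 2 := by nlinarith
  have hsum : ∑ k, Real.sin (principalAngle P P' k) ^ 2 ≤ u ^ 2 := by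
    rw [sum_sin_principalAngle_sq]
    have := pow_le_pow_left₀ (by positivity) hu 2
    rwa [div_pow, Real.sq_sqrt zero_le_two] at this
  rw [s.dist_eq, ← Real.sqrt_sq hu0, ← Real.sqrt_div (sq_nonneg u), Real.sqrt_sq hu0]
  refine Real.sqrt_le_sqrt ?_
  rw [le_div_iff₀ hu2, Finset.sum_mul]
  refine le_trans (Finset.sum_le_sum fun k _ => ?_) hsum
  have h0 := principalAngle_nonneg P P' k
  have h1 := principalAngle_le P P' k
  set θ := principalAngle P P' k
  have h2 : Real.sin θ ^ 2 ≤ u ^ 2 :=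
    (Finset.single_le_sum (f := fun k => Real.sin (principalAngle P P' k) ^ 2)
      (fun _ _ => sq_nonneg _) (Finset.mem_univ k)).trans hsum
  have h3 : 0 ≤ Real.sin θ := Real.sin_nonneg_of_nonneg_of_le_pi h0 (by linarith [Real.pi_pos])
  have h4 : 0 ≤ Real.cos θ := Real.cos_nonneg_of_neg_pi_div_two_le_of_le
    (by linarith [Real.pi_pos]) h1
  obtain ⟨h5, h6⟩ := s.sin_le_angleFun h0 h1
  calc s.angleFun θ ^ 2 * (1 - u ^ 2) ≤ θ ^ 2 * Real.cos θ ^ 2 := by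
        refine mul_le_mul (pow_le_pow_left₀ (h3.trans h5) h6 2) ?_ hu2.le (sq_nonneg _)
        linarith [Real.sin_sq_add_cos_sq θ]
    _ = (θ * Real.cos θ) ^ 2 := by ring
    _ ≤ Real.sin θ ^ 2 := pow_le_pow_left₀ (by positivity) (mul_cos_le_sin h0 h1) 2

end

/-! ### The condition number -/

section

variable {m n : ℕ} {A : Matrix (Fin m) (Fin n) 𝕜} {U : Matrix (Fin m) (Fin m) 𝕜} {σ : Fin m → ℝ}
  {V : Matrix (Fin n) (Fin n) 𝕜} {π : Finset (Fin m)}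

theorem ne_of_mem_leftDomain (hA : A ∈ leftDomain 𝕜 n π) (h : IsFullSVD A U σ V) :
    ∀ i ∈ π, ∀ j ∉ π, σ i ≠ σ j := by
  obtain ⟨U₀, σ₀, V₀, h₀, hW⟩ := hA
  intro i hi j hj
  rw [h₀.sigma_unique h]
  exact h₀.ne_of_isLeftSingularSubspace hW hi hj

theorem exists_leftMap_eq (B : leftDomain 𝕜 n π) : ∃ U' σ' V',
    IsFullSVD (B : Matrix (Fin m) (Fin n) 𝕜) U' σ' V' ∧
      (leftMap π B : Matrix (Fin m) (Fin m) 𝕜) = colProj π U' :=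
  ⟨_, _, _, B.2.choose_spec.choose_spec.choose_spec.1, rfl⟩

theorem IsFullSVD.leftMap_eq (h : IsFullSVD A U σ V) (hA : A ∈ leftDomain 𝕜 n π) :
    (leftMap π ⟨A, hA⟩ : Matrix (Fin m) (Fin m) 𝕜) = colProj π U := by
  obtain ⟨U', σ', V', h', he⟩ := exists_leftMap_eq ⟨A, hA⟩
  rw [he]
  exact colProj_unique h h' (ne_of_mem_leftDomain hA h)

/-- `A` is an interior point of the domain. -/
theorem mem_leftDomain_of_near (h : IsFullSVD A U σ V) (hA : A ∈ leftDomain 𝕜 n π) :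
    ∃ δ : ℝ, 0 < δ ∧ ∀ B : Matrix (Fin m) (Fin n) 𝕜, ‖B - A‖ ≤ δ → B ∈ leftDomain 𝕜 n π := by
  obtain ⟨C, δ, -, hδ, hexp⟩ := exists_expansion h (ne_of_mem_leftDomain hA h)
  refine ⟨δ, hδ, fun B hB => ?_⟩
  obtain ⟨U', σ', V', h'⟩ := exists_isFullSVD B
  exact ⟨U', σ', V', h', h'.isLeftSingularSubspace (hexp B U' σ' V' h' hB).1⟩

/-- The chordal distance of the images agrees with the size of the first order change, up to a
remainder of second order. -/
theorem exists_chordal_expansion (h : IsFullSVD A U σ V) (hA : A ∈ leftDomain 𝕜 n π) :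
    ∃ C δ : ℝ, 0 ≤ C ∧ 0 < δ ∧ ∀ B : leftDomain 𝕜 n π, ‖(B : Matrix (Fin m) (Fin n) 𝕜) - A‖ ≤ δ →
      |‖(leftMap π B : Matrix (Fin m) (Fin m) 𝕜) - leftMap π ⟨A, hA⟩‖ / √2 -
        ‖firstOrder π σ (Uᴴ * (((B : Matrix (Fin m) (Fin n) 𝕜) - A) * Aᴴ +
          A * ((B : Matrix (Fin m) (Fin n) 𝕜) - A)ᴴ) * U)‖ / √2| ≤
        C * ‖(B : Matrix (Fin m) (Fin n) 𝕜) - A‖ ^ 2 := by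
  obtain ⟨C, δ, hC, hδ, hexp⟩ := exists_expansion h (ne_of_mem_leftDomain hA h)
  refine ⟨C, δ, hC, hδ, fun B hB => ?_⟩
  obtain ⟨U', σ', V', h', he⟩ := exists_leftMap_eq B
  have h1 := (hexp B U' σ' V' h' hB).2
  rw [he, h.leftMap_eq hA, ← norm_conj_unitary h.unitary_left h.unitary_left, ← sub_div, abs_div,
    abs_of_pos (Real.sqrt_pos.2 zero_lt_two)]
  refine (div_le_self (abs_nonneg _) ?_).trans ((abs_norm_sub_norm_le _ _).trans h1)
  rw [Real.one_le_sqrt]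
  exact one_le_two

/-- An upper bound of the distance with a factor that tends to `κ` as `B` tends to `A`. -/
theorem exists_dist_le (h : IsFullSVD A U σ V) (hA : A ∈ leftDomain 𝕜 n π) {κ : ℝ}
    (hκ0 : 0 ≤ κ) (hκ : ∀ a b, ¬(a ∈ π ↔ b ∈ π) → inverseGap (σ a) (σ b) ≤ κ) (s : GrMetric) :
    ∃ (F : ℝ → ℝ) (δ : ℝ), Tendsto F (𝓝 0) (𝓝 κ) ∧ 0 < δ ∧ ∀ B : leftDomain 𝕜 n π,
      ‖(B : Matrix (Fin m) (Fin n) 𝕜) - A‖ ≤ δ → s.dist (leftMap π ⟨A, hA⟩) (leftMap π B) ≤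
        F ‖(B : Matrix (Fin m) (Fin n) 𝕜) - A‖ * ‖(B : Matrix (Fin m) (Fin n) 𝕜) - A‖ := by
  obtain ⟨C, δ, hC, hδ, hexp⟩ := exists_chordal_expansion h hA
  set u : ℝ → ℝ := fun x => (κ + C * x) * x with hu
  have hucont : Continuous u := by fun_prop
  have hu0 : u 0 = 0 := by simp [hu]
  have hev : ∀ᶠ x in 𝓝 (0 : ℝ), u x < 1 :=
    hucont.continuousAt.eventually_lt continuousAt_const (by rw [hu0]; exact one_pos)
  obtain ⟨η, hη, hball⟩ := Metric.eventually_nhds_iff.1 hev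
  refine ⟨fun x => (κ + C * x) / √(1 - u x ^ 2), min δ (η / 2), ?_, by positivity, fun B hB => ?_⟩
  · have hcont : ContinuousAt (fun x => (κ + C * x) / √(1 - u x ^ 2)) 0 := by
      refine ContinuousAt.div (by fun_prop) ?_ (by simp [hu0])
      exact (Real.continuous_sqrt.comp (by fun_prop)).continuousAt
    have := hcont.tendsto
    simpa [hu0] using this
  · set x := ‖(B : Matrix (Fin m) (Fin n) 𝕜) - A‖ with hx
    have hx0 : 0 ≤ x := norm_nonneg _
    have hu1 : u x < 1 := by
      refine hball ?_
      rw [Real.dist_eq, sub_zero, abs_of_nonneg hx0]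
      have := hB.trans (min_le_right _ _)
      linarith
    have h1 := (abs_le.1 (hexp B (hB.trans (min_le_left _ _)))).2
    have h2 := h.sq_norm_firstOrder_le hκ ((B : Matrix (Fin m) (Fin n) 𝕜) - A)
    have h3 : ‖firstOrder π σ (Uᴴ * (((B : Matrix (Fin m) (Fin n) 𝕜) - A) * Aᴴ +
          A * ((B : Matrix (Fin m) (Fin n) 𝕜) - A)ᴴ) * U)‖ / √2 ≤ κ * x := by
      refine le_of_sq_le_sq ?_ (by positivity)
      rw [div_pow, Real.sq_sqrt zero_le_two, div_le_iff₀ zero_lt_two]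
      linarith
    have h4 := s.dist_le (leftMap π ⟨A, hA⟩) (leftMap π B) (u := u x) (by positivity) hu1 (by
      rw [← hx] at h1
      simp only [hu]
      linarith)
    refine h4.trans (le_of_eq ?_)
    simp only [hu]
    ring

/-- Along the worst direction the distance is at least `κ * ‖t • A'‖`, up to a remainder of second
order. -/
theorem exists_le_dist_worstDirection (h : IsFullSVD A U σ V) (hA : A ∈ leftDomain 𝕜 n π)
    {i j : Fin m} (hi : i ∈ π) (hj : j ∉ π) (s : GrMetric) :
    ∃ C δ : ℝ, 0 < δ ∧ ∀ (t : ℝ)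
      (ht : A + t • worstDirection A.rank U σ V i j ∈ leftDomain 𝕜 n π),
      ‖t • worstDirection A.rank U σ V i j‖ ≤ δ →
      (inverseGap (σ i) (σ j) - C * ‖t • worstDirection A.rank U σ V i j‖) *
        ‖t • worstDirection A.rank U σ V i j‖ ≤
          s.dist (leftMap π ⟨A, hA⟩) (leftMap π ⟨_, ht⟩) := by
  obtain ⟨C, δ, hC, hδ, hexp⟩ := exists_chordal_expansion h hA
  have hij := ne_of_mem_leftDomain hA h i hi j hj
  refine ⟨C, δ, hδ, fun t ht hB => ?_⟩
  have h1 := (abs_le.1 (hexp ⟨_, ht⟩ (by rwa [add_sub_cancel_left]))).1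
  have h2 := h.le_norm_firstOrder_worstDirection hi hj hij t
  have h3 := h.inverseGap_mul_norm_worstDirection_le hij
  simp only [add_sub_cancel_left] at h1
  have h4 : |t| ≤ ‖firstOrder π σ (Uᴴ * ((t • worstDirection A.rank U σ V i j) * Aᴴ +
      A * (t • worstDirection A.rank U σ V i j)ᴴ) * U)‖ / √2 := by
    refine le_of_sq_le_sq ?_ (by positivity)
    rw [div_pow, Real.sq_sqrt zero_le_two, le_div_iff₀ zero_lt_two, sq_abs]
    linarith
  have h5 : inverseGap (σ i) (σ j) * ‖t • worstDirection A.rank U σ V i j‖ ≤ |t| := by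
    rw [norm_smul, Real.norm_eq_abs]
    nlinarith [abs_nonneg t]
  have h6 := s.le_dist (leftMap π ⟨A, hA⟩) (leftMap π ⟨_, ht⟩)
  nlinarith

theorem IsFullSVD.worstDirection_ne_zero (h : IsFullSVD A U σ V) {i j : Fin m}
    (hij : σ i ≠ σ j) : worstDirection A.rank U σ V i j ≠ 0 := by
  intro h0
  -- for `π = {i}` the first order change in this direction does not vanish
  have h1 := h.le_norm_firstOrder_worstDirection (π := {i}) (Finset.mem_singleton_self i)
    (fun hj => hij (by rw [Finset.mem_singleton.1 hj])) hij 1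
  rw [h0] at h1
  have h2 : firstOrder {i} σ (0 : Matrix (Fin m) (Fin m) 𝕜) = 0 := by
    ext a b
    simp [firstOrder]
  simp only [smul_zero, Matrix.zero_mul, Matrix.conjTranspose_zero, Matrix.mul_zero, add_zero,
    h2, norm_zero] at h1
  norm_num at h1

end

end SingularSubspace

theorem proposition2 {𝕜 : Type*} [RCLike 𝕜] {m n : ℕ} (π : Finset (Fin m))
    (A : Matrix (Fin m) (Fin n) 𝕜) (hA : A ∈ SingularSubspace.leftDomain 𝕜 n π)
    (U : Matrix (Fin m) (Fin m) 𝕜) (σ : Fin m → ℝ) (V : Matrix (Fin n) (Fin n) 𝕜)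
    (hSVD : SingularSubspace.IsFullSVD A U σ V)
    (i j : Fin m) (hi : i ∈ π) (hj : j ∉ π)
    (hmax : ∀ i' ∈ π, ∀ j' ∉ π, SingularSubspace.inverseGap (σ i') (σ j') ≤
      SingularSubspace.inverseGap (σ i) (σ j))
    (A' : Matrix (Fin m) (Fin n) 𝕜)
    (hA' : A' = SingularSubspace.worstDirection A.rank U σ V i j)
    (s : SingularSubspace.GrMetric) :
    SingularSubspace.leftCond s π ⟨A, hA⟩ ≠ ⊤ ∧ A' ≠ 0 ∧
    ∃ h : ℝ → ℝ, Tendsto h (𝓝[≠] 0) (𝓝 0) ∧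
      ∀ᶠ t : ℝ in 𝓝[≠] 0, ∃ ht : A + t • A' ∈ SingularSubspace.leftDomain 𝕜 n π,
        s.dist (SingularSubspace.leftMap π ⟨A, hA⟩) (SingularSubspace.leftMap π ⟨A + t • A', ht⟩) =
          (SingularSubspace.leftCond s π ⟨A, hA⟩).toReal * ‖t • A'‖ * (1 + h t) := by
  open SingularSubspace in
  classical
  subst hA'
  have hij := ne_of_mem_leftDomain hA hSVD i hi j hj
  have hne := hSVD.worstDirection_ne_zero hij
  obtain ⟨C, δ₁, hδ₁, hlow⟩ := exists_le_dist_worstDirection hSVD hA hi hj s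
  obtain ⟨δ₃, hδ₃, hdom⟩ := mem_leftDomain_of_near hSVD hA
  set κ := inverseGap (σ i) (σ j) with hκdef
  set A' := worstDirection A.rank U σ V i j with hA'
  have hκ0 : 0 < κ := by
    have h1 : σ i ^ 2 ≠ σ j ^ 2 := fun h0 =>
      hij ((sq_eq_sq₀ (hSVD.nonneg i) (hSVD.nonneg j)).1 h0)
    have h2 : 0 < κ ^ 2 := by
      rw [hκdef, inverseGap_sq]
      have h3 : 0 < (σ i ^ 2 - σ j ^ 2) ^ 2 := by
        have := sub_ne_zero.2 h1
        positivity
      have h4 : 0 < σ i ^ 2 + σ j ^ 2 := by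
        rcases h1.lt_or_gt with h5 | h5 <;> nlinarith [sq_nonneg (σ i), sq_nonneg (σ j)]
      positivity
    exact lt_of_le_of_ne (inverseGap_nonneg _ _) fun h0 => by
      rw [← h0] at h2
      norm_num at h2
  have hκ : ∀ a b, ¬(a ∈ π ↔ b ∈ π) → inverseGap (σ a) (σ b) ≤ κ := fun a b hab => by
    by_cases ha : a ∈ π
    · exact hmax a ha b fun hb => hab ⟨fun _ => hb, fun _ => ha⟩
    · have hb : b ∈ π := by
        by_contra hb
        exact hab ⟨fun h => absurd h ha, fun h => absurd h hb⟩
      rw [inverseGap_comm]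
      exact hmax b hb a ha
  obtain ⟨F, δ₂, hF, hδ₂, hup⟩ := exists_dist_le hSVD hA hκ0.le hκ s
  -- the step `‖t • A'‖` tends to `0` and is positive
  have hstep : Tendsto (fun t : ℝ => ‖t • A'‖) (𝓝[≠] 0) (𝓝 0) := by
    have h1 : Continuous fun t : ℝ => ‖t • A'‖ := by fun_prop
    simpa using (h1.tendsto 0).mono_left nhdsWithin_le_nhds
  have hsmall : ∀ δ : ℝ, 0 < δ → ∀ᶠ t : ℝ in 𝓝[≠] 0, ‖t • A'‖ ≤ δ := fun δ hδ =>
    (hstep.eventually_lt_const hδ).mono fun _ h => h.le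
  have hpos : ∀ᶠ t : ℝ in 𝓝[≠] 0, 0 < ‖t • A'‖ := by
    filter_upwards [self_mem_nhdsWithin] with t ht
    exact norm_pos_iff.2 (smul_ne_zero ht hne)
  have hmem : ∀ᶠ t : ℝ in 𝓝[≠] 0, A + t • A' ∈ leftDomain 𝕜 n π :=
    (hsmall δ₃ hδ₃).mono fun t ht => hdom _ (by rwa [add_sub_cancel_left])
  set ρ : ℝ → ℝ := fun t => if ht : A + t • A' ∈ leftDomain 𝕜 n π then
    s.dist (leftMap π ⟨A, hA⟩) (leftMap π ⟨A + t • A', ht⟩) / ‖t • A'‖ else 0 with hρ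
  have hρlim : Tendsto ρ (𝓝[≠] 0) (𝓝 κ) := by
    have hl : Tendsto (fun t : ℝ => κ - C * ‖t • A'‖) (𝓝[≠] 0) (𝓝 κ) := by
      simpa using tendsto_const_nhds.sub (hstep.const_mul C)
    refine tendsto_of_tendsto_of_tendsto_of_le_of_le' hl (hF.comp hstep) ?_ ?_
    · filter_upwards [hmem, hpos, hsmall δ₁ hδ₁] with t ht h0 h1
      simp only [hρ, dif_pos ht]
      rw [le_div_iff₀ h0]
      exact hlow t ht h1
    · filter_upwards [hmem, hpos, hsmall δ₂ hδ₂] with t ht h0 h2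
      simp only [hρ, dif_pos ht, Function.comp]
      rw [div_le_iff₀ h0]
      have := hup ⟨_, ht⟩ (by rwa [add_sub_cancel_left])
      rwa [add_sub_cancel_left] at this
  have hcond : leftCond s π ⟨A, hA⟩ = ENNReal.ofReal κ := by
    apply le_antisymm
    · have hlim : Tendsto (fun K : ℝ => ENNReal.ofReal K) (𝓝[>] κ) (𝓝 (ENNReal.ofReal κ)) :=
        (ENNReal.continuous_ofReal.tendsto κ).mono_left nhdsWithin_le_nhds
      refine ge_of_tendsto hlim ?_
      filter_upwards [self_mem_nhdsWithin] with K hK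
      obtain ⟨η, hη, hball⟩ := Metric.eventually_nhds_iff.1 (hF.eventually_le_const hK)
      refine iInf₂_le_of_le (min δ₂ (η / 2)) (by positivity) (iSup₂_le fun B hB => ?_)
      refine ENNReal.ofReal_le_ofReal ?_
      have hBA : ‖A - (B : Matrix (Fin m) (Fin n) 𝕜)‖ = ‖(B : Matrix (Fin m) (Fin n) 𝕜) - A‖ :=
        norm_sub_rev _ _
      simp only [hBA] at hB ⊢
      rw [div_le_iff₀ hB.1]
      refine (hup B (hB.2.trans (min_le_left _ _))).trans ?_
      refine mul_le_mul_of_nonneg_right (hball ?_) (norm_nonneg _)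
      rw [Real.dist_eq, sub_zero, abs_of_pos hB.1]
      have := hB.2.trans (min_le_right _ _)
      linarith
    · refine le_iInf₂ fun ε hε => ?_
      refine le_of_tendsto ((ENNReal.continuous_ofReal.tendsto κ).comp hρlim) ?_
      filter_upwards [hmem, hpos, hsmall ε hε] with t ht h0 h1
      have hBA : ‖A - (A + t • A')‖ = ‖t • A'‖ := by
        rw [norm_sub_rev, add_sub_cancel_left]
      refine le_iSup₂_of_le (⟨A + t • A', ht⟩ : leftDomain 𝕜 n π) ?_ ?_
      · simp only [hBA]
        exact ⟨h0, h1⟩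
      · simp only [hBA, Function.comp, hρ, dif_pos ht]
        exact le_rfl
  refine ⟨by rw [hcond]; exact ENNReal.ofReal_ne_top, hne, fun t => ρ t / κ - 1, ?_, ?_⟩
  · have h1 := (hρlim.div_const κ).sub_const 1
    rwa [div_self hκ0.ne', sub_self] at h1
  · filter_upwards [hmem, hpos] with t ht h0
    refine ⟨ht, ?_⟩
    rw [hcond, ENNReal.toReal_ofReal hκ0.le]
    simp only [hρ, dif_pos ht]
    field_simp
    ring
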